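/- Let $d\in\mathbb N$. A \emph{symbol} on a finite-dimensional Hilbert space is an operator $Q$ with $0\le Q\le \mathbb 1$, and its entropy is $$\mathsf H(Q) = -\operatorname{tr}\bigl[Q\log Q + (\mathbb 1-Q)\log(\mathbb 1-Q)\bigr],\qquad 0\log 0=0 .$$ A \emph{quasi-free CP map} $\mathcal H_1\to\mathcal H_2$ is a couple $(A,B)$ of linear maps $A:\mathcal H_1\to\mathcal H_2$, $B:\mathcal H_1\to\mathcal H_1$ with $0\le B\le \mathbb 1-A^*A$. It sends a symbol $Q$ on $\mathcal H_2$ to the symbol $A^*QA+B$ on $\mathcal H_1$; composition is $(A,B)\circ(A',B')=(AA',B'+A'^*BA')$, the identity is $(\mathbb 1,0)$, and parallel application to a bipartite system is the direct sum. Let $(A,B)$ be a quasi-free CP map from $\mathbb C^d$ to itself and let $X$ be a $d\times d$ matrix for which $$\Lambda=(C,D),\qquad C=\begin{pmatrix}A&A\end{pmatrix},\qquad D=\begin{pmatrix}B&X\\X^*&B\end{pmatrix}$$ is a quasi-free CP map $\mathbb C^d\oplus\mathbb C^d\to\mathbb C^d$ (a compatible extension of $(A,B)$). Let $Q$ be the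 solution of $Q=A^*QA+B$. Put $\Lambda_0=\mathrm{id}$ on $\mathbb C^d$ (the memory) and $\Lambda_{n+1}=\Lambda\circ(\Lambda_n\oplus\mathrm{id}):\mathbb C^d\oplus\bigl(\bigoplus_0^{n}\mathbb C^d\bigr)\to\mathbb C^d$. The process has on its first $n$ sites the symbol $Q_n$ on $\bigoplus_0^{n-1}\mathbb C^d$ that is obtained by applying $\Lambda_n$ to $Q$ and restricting to the $n$ sites (discarding the memory). Then all $Q_n$ are symbols, $\mathbb 1-A^*e^{i\theta}$ is invertible for every real $\theta$, and, with $$Q_\infty(\theta)=Q+\Bigl[A^*e^{i\theta}\bigl(\mathbb 1-A^*e^{i\theta}\bigr)^{-1}(Q-B+X)+\text{h.c.}\Bigr],$$ where h.c. denotes the Hermitian conjugate of the other term in the brackets, the following hold. For every $\theta$, $Q_\infty(\theta)$ is a symbol on $\mathbb C^d$. The $Q_n$ are the principal sub-matrices of the block Toeplitz matrix of $Q_\infty(\cdot)$: $$(Q_n)_{jk}=\frac1{2\pi}\int_{-\pi}^{\pi}Q_\infty(\theta)\,e^{-i(k-j)\theta}\,d\theta,\qquad 0\le j,k<n .$$ The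 function $\theta\mapsto\mathsf H(Q_\infty(\theta))$ is integrable on $[-\pi,\pi]$. Finally the entropy density $\mathsf h$ of the process exists, both as average entropy and as asymptotic entropy production, and $$\mathsf h=\lim_{n\to\infty}\frac{\mathsf H(Q_{n+1})}{n+1}=\lim_{n\to\infty}\bigl(\mathsf H(Q_{n+1})-\mathsf H(Q_n)\bigr)=\frac1{2\pi}\int_{-\pi}^{\pi}\mathsf H\bigl(Q_\infty(\theta)\bigr)\,d\theta .$$ -/

import Mathlib

open scoped Matrix Topology ComplexOrder

noncomputable section

/-- A symbol on the mode space `ℂ^ι`: an operator with `0 ≤ Q ≤ 1`. -/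
def IsSymbol {ι : Type*} [Fintype ι] [DecidableEq ι] (Q : Matrix ι ι ℂ) : Prop :=
  Q.PosSemidef ∧ (1 - Q).PosSemidef

/-- The von Neumann entropy `-tr [Q log Q + (1 - Q) log (1 - Q)]` of a symbol, with the natural
logarithm applied by functional calculus. Since `Real.log 0 = 0`, the convention
`0 log 0 = 0` is respected. -/
def symbolEntropy {ι : Type*} [Fintype ι] [DecidableEq ι] (Q : Matrix ι ι ℂ) : ℝ :=
  -(Matrix.trace (Q * cfc Real.log Q + (1 - Q) * cfc Real.log (1 - Q))).re

/-- A couple `(A, B)` of linear maps `A : ℂ^ι → ℂ^κ`, `B : ℂ^ι → ℂ^ι`. -/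
structure FreeMap (ι κ : Type*) where
  /-- the Kraus-like part -/
  A : Matrix κ ι ℂ
  /-- the additive part -/
  B : Matrix ι ι ℂ

namespace FreeMap

/-- Complete positivity of a free map: `0 ≤ B ≤ 1 - A* A`. -/
def IsCP {ι κ : Type*} [Fintype ι] [DecidableEq ι] [Fintype κ] (Γ : FreeMap ι κ) : Prop :=
  Γ.B.PosSemidef ∧ (1 - Γ.Aᴴ * Γ.A - Γ.B).PosSemidef

/-- The action on symbols, `Q ↦ A* Q A + B`. -/
def act {ι κ : Type*} [Fintype κ] (Γ : FreeMap ι κ) (Q : Matrix κ κ ℂ) : Matrix ι ι ℂ :=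
  Γ.Aᴴ * Q * Γ.A + Γ.B

/-- The identity map `(1, 0)`. -/
def ident (ι : Type*) [DecidableEq ι] : FreeMap ι ι := ⟨1, 0⟩

/-- Composition `(A, B) ∘ (A', B') = (A A', B' + A'* B A')`. -/
def comp {ι κ l : Type*} [Fintype κ] (Γ : FreeMap κ l) (Γ' : FreeMap ι κ) : FreeMap ι l :=
  ⟨Γ.A * Γ'.A, Γ'.B + Γ'.Aᴴ * Γ.B * Γ'.A⟩

/-- Parallel application of two free maps to a bipartite system: the direct sum. -/
def directSum {ι κ ι' κ' : Type*} (Γ : FreeMap ι κ) (Γ' : FreeMap ι' κ') :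
    FreeMap (ι ⊕ ι') (κ ⊕ κ') :=
  ⟨Matrix.fromBlocks Γ.A 0 0 Γ'.A, Matrix.fromBlocks Γ.B 0 0 Γ'.B⟩

/-- Relabelling of the modes of the domain. -/
def relabel {ι ι' κ : Type*} (e : ι ≃ ι') (Γ : FreeMap ι κ) : FreeMap ι' κ :=
  ⟨Matrix.reindex (Equiv.refl κ) e Γ.A, Matrix.reindex e e Γ.B⟩

end FreeMap

/-- The extension `C = (A A)`, `D = [[B, X], [X*, B]]` of `(A, B)` labelled by `X`. -/
def compatibleExtension {d : ℕ} (A B X : Matrix (Fin d) (Fin d) ℂ) :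
    FreeMap (Fin d ⊕ Fin d) (Fin d) :=
  ⟨Matrix.fromCols A A, Matrix.fromBlocks B X Xᴴ B⟩

/-- Memory, then `n` sites, then one more site, seen as memory followed by `n + 1` sites;
the additional site becomes the last one. -/
def appendSite (d n : ℕ) :
    (Fin d ⊕ (Fin n × Fin d)) ⊕ Fin d ≃ Fin d ⊕ (Fin (n + 1) × Fin d) :=
  (Equiv.sumAssoc _ _ _).trans <| Equiv.sumCongr (Equiv.refl _) <|
    (Equiv.sumCongr (Equiv.refl _) (Equiv.uniqueProd (Fin d) (Fin 1)).symm).trans <|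
      (Equiv.sumProdDistrib _ _ _).symm.trans (Equiv.prodCongr finSumFinEquiv (Equiv.refl _))

/-- The maps generating the process, indexed by the number `n` of emitted sites:
`iterate Λ 0` is the identity of the memory, and
`iterate Λ (n + 1) = Λ ∘ (iterate Λ n ⊕ id)`, where `id` acts on the last site. -/
def FreeMap.iterate {d : ℕ} (Λ : FreeMap (Fin d ⊕ Fin d) (Fin d)) :
    (n : ℕ) → FreeMap (Fin d ⊕ (Fin n × Fin d)) (Fin d)
  | 0 => (FreeMap.ident (Fin d)).relabel (Equiv.sumEmpty (Fin d) (Fin 0 × Fin d)).symm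
  | n + 1 => (Λ.comp ((iterate Λ n).directSum (FreeMap.ident (Fin d)))).relabel (appendSite d n)

/-- The symbol of the process on its first `n` sites: the memory is put in the symbol `Q`, `n`
sites are emitted, and the result is restricted to the sites (the memory is discarded). -/
def processMarginal {d : ℕ} (Λ : FreeMap (Fin d ⊕ Fin d) (Fin d)) (Q : Matrix (Fin d) (Fin d) ℂ)
    (n : ℕ) : Matrix (Fin n × Fin d) (Fin n × Fin d) ℂ :=
  ((Λ.iterate n).act Q).toBlocks₂₂

/-- `Q + A* e^{iθ} (1 - A* e^{iθ})⁻¹ (Q - B + X) + h.c.`, the Hermitian conjugate being that of the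
second term. -/
def toeplitzSymbol {d : ℕ} (A B X Q : Matrix (Fin d) (Fin d) ℂ) (θ : ℝ) :
    Matrix (Fin d) (Fin d) ℂ :=
  let z : ℂ := Complex.exp (Complex.I * θ)
  let G := (z • Aᴴ) * (1 - z • Aᴴ)⁻¹ * (Q - B + X)
  Q + (G + Gᴴ)

end

/-!
# Entropy density of a quasi-free process generated by a compatible extension

Write `Y = Q - B + X`. Solving the recursion shows that the marginal on `n` sites is the block
Toeplitz matrix with `Q` on the diagonal and `A*ᵐ Y` on the `m`-th upper diagonal
(`processMarginal_eq_blockToeplitz`). Complete positivity of the extension forces `2 A* A ≤ 1`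
(`norm_lt_one_of_isCP`), so that these blocks decay exponentially and `1 - z A*` is invertible on
the unit circle. With `K = z A* (1 - z A*)⁻¹` the Toeplitz symbol is
`(K 1) [[B, X], [X*, B]] (K 1)*` (`toeplitzSymbol_eq_conj`); this is positive because the extension
is completely positive, and the same identity for the complementary data handles `1 - σ`.

The average entropy is a Szegő limit. The block circulant matrix built from the values of the symbol
at the `N`-th roots of unity differs from the Toeplitz matrix only by an aliasing error, which is
summable over all entries uniformly in `N` (`fourierSum_toeplitzSymbol`,
`sum_norm_blockToeplitz_sub_blockCirculant_le`). Hence traces of a fixed polynomial in the two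
matrices, which are contractions, differ by `O(1)`. Approximating the binary entropy uniformly by
polynomials shows that `H(Q_N) / N` is asymptotic to the mean of the entropies of the values of the
symbol, a Riemann sum of the limiting integral (`tendsto_entropy_blockToeplitz`). The Fourier
representation of the marginals is obtained from the same sums.

The entropy increments converge because they decrease: this is strong subadditivity applied to the
first site, the last site, and the sites between (`symbolEntropy_blockToeplitz_concave`). Strong
subadditivity is reduced to determinants. For `s > 0`, `M ↦ log det (s + M)` is submodular on
principal submatrices by Fischer's inequality for a Schur complement
(`Matrix.PosDef.det_mul_det_le`).
As `log` is the derivative of `x log x - x`, integrating in `s` from infinity, where the signed sum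
vanishes, gives the submodularity of `tr (-M log M)` (`sum_mul_log_nonneg_of_sum_log_nonpos`,
`Matrix.PosSemidef.trace_negMulLog_submodular`). Apply it to a symbol `Q` and to `1 - Q`.
-/

open Filter

/-! ### Determinantal inequalities -/

namespace Matrix

section Determinants

variable {α β γ ι : Type*} [Fintype α] [DecidableEq α] [Fintype β] [DecidableEq β]
  [Fintype γ] [DecidableEq γ] [Fintype ι] [DecidableEq ι]

theorem IsHermitian.det_smul_one_add {M : Matrix ι ι ℂ} (hM : M.IsHermitian) (s : ℝ) :
    ((s : ℂ) • (1 : Matrix ι ι ℂ) + M).det = ∏ i, ((s + hM.eigenvalues i : ℝ) : ℂ) := by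
  have h := congrArg (fun p => Polynomial.eval (-s : ℂ) p) hM.charpoly_eq
  simp only [eval_charpoly, Polynomial.eval_prod, Polynomial.eval_sub, Polynomial.eval_X,
    Polynomial.eval_C] at h
  have h1 : (scalar ι (-s : ℂ) - M) = -((s : ℂ) • (1 : Matrix ι ι ℂ) + M) := by
    rw [map_neg, smul_one_eq_diagonal]; simp; abel
  have h2 : ∀ i, (-s - (hM.eigenvalues i : ℂ)) = (-1) * (s + (hM.eigenvalues i : ℂ)) :=
    fun i => by ring
  rw [h1, det_neg] at h
  simp only [Complex.coe_algebraMap, h2, Finset.prod_mul_distrib, Finset.prod_const,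
    Finset.card_univ] at h
  simpa using mul_left_cancel₀ (pow_ne_zero _ (by norm_num)) h

theorem PosSemidef.one_le_det_one_add {M : Matrix ι ι ℂ} (hM : M.PosSemidef) :
    1 ≤ (1 + M).det := by
  have hU := hM.1.det_smul_one_add 1
  rw [Complex.ofReal_one, one_smul] at hU
  rw [hU, ← Complex.ofReal_prod]
  have : (1 : ℝ) ≤ ∏ i, (1 + hM.1.eigenvalues i) := by
    have := Finset.prod_le_prod (s := Finset.univ) (f := fun _ : ι => (1 : ℝ))
      (g := fun i => 1 + hM.1.eigenvalues i) (fun _ _ => zero_le_one)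
      fun i _ => by linarith [hM.eigenvalues_nonneg i]
    simpa using this
  exact_mod_cast Complex.real_le_real.mpr this

/-- The determinant is monotone for the Loewner order. -/
theorem PosDef.det_le_det_add {M N : Matrix ι ι ℂ} (hM : M.PosDef) (hN : N.PosSemidef) :
    M.det ≤ (M + N).det := by
  obtain ⟨S, hS⟩ : ∃ S : Matrix ι ι ℂ, M = Sᴴ * S := by
    open scoped MatrixOrder in
    exact CStarAlgebra.nonneg_iff_eq_star_mul_self.mp hM.posSemidef.nonneg
  have hdet : IsUnit S.det := by
    have := hM.det_pos.ne'
    rw [hS, det_mul] at this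
    exact (right_ne_zero_of_mul this).isUnit
  have hT := hN.conjTranspose_mul_mul_same S⁻¹
  have hMN : M + N = Sᴴ * (1 + (S⁻¹)ᴴ * N * S⁻¹) * S := by
    have e1 : S⁻¹ * S = 1 := nonsing_inv_mul S hdet
    have e2 : Sᴴ * (S⁻¹)ᴴ = 1 := by rw [← conjTranspose_mul, e1, conjTranspose_one]
    calc M + N = Sᴴ * S + (Sᴴ * (S⁻¹)ᴴ) * N * (S⁻¹ * S) := by rw [hS, e1, e2]; simp
      _ = _ := by noncomm_ring
  have h1 : (M + N).det = M.det * (1 + (S⁻¹)ᴴ * N * S⁻¹).det := by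
    rw [hMN, hS]; simp only [det_mul]; ring
  rw [h1]
  exact le_mul_of_one_le_right hM.det_pos.le hT.one_le_det_one_add

/-- The Schur complement of a block of a positive definite matrix is positive definite. -/
theorem PosDef.schur_complement {P : Matrix α α ℂ} {R : Matrix α γ ℂ} {S : Matrix γ γ ℂ}
    (h : (fromBlocks P R Rᴴ S).PosDef) :
    P.PosDef ∧ (S - Rᴴ * P⁻¹ * R).PosDef ∧
      (fromBlocks P R Rᴴ S).det = P.det * (S - Rᴴ * P⁻¹ * R).det := by
  have hP : P.PosDef := h.submatrix (e := Sum.inl) Sum.inl_injective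
  let _ := hP.isUnit.invertible
  have hd := det_fromBlocks₁₁ P R Rᴴ S
  rw [invOf_eq_nonsing_inv] at hd
  refine ⟨hP, ?_, hd⟩
  refine ((hP.fromBlocks₁₁ R S).mp h.posSemidef).posDef_iff_det_ne_zero.mpr ?_
  have := h.det_pos.ne'
  rw [hd] at this
  exact right_ne_zero_of_mul this

/-- Fischer's inequality. -/
theorem PosDef.det_fromBlocks_le {P : Matrix α α ℂ} {R : Matrix α γ ℂ} {S : Matrix γ γ ℂ}
    (h : (fromBlocks P R Rᴴ S).PosDef) : (fromBlocks P R Rᴴ S).det ≤ P.det * S.det := by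
  obtain ⟨hP, hS, hd⟩ := h.schur_complement
  rw [hd]
  refine mul_le_mul_of_nonneg_left ?_ hP.det_pos.le
  have := hS.det_le_det_add (hP.inv.posSemidef.conjTranspose_mul_mul_same R)
  simpa using this

/-- Restricting the second block of a positive definite matrix restricts its Schur complement. -/
theorem PosDef.det_submatrix_sum_map {δ : Type*} {P : Matrix β β ℂ} {R : Matrix β δ ℂ}
    {S : Matrix δ δ ℂ}
    (h : (fromBlocks P R Rᴴ S).PosDef) {f : α → δ} (hf : f.Injective) :
    ((fromBlocks P R Rᴴ S).submatrix (Sum.map id f) (Sum.map id f)).det =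
      P.det * ((S - Rᴴ * P⁻¹ * R).submatrix f f).det := by
  have e : (fromBlocks P R Rᴴ S).submatrix (Sum.map id f) (Sum.map id f) =
      fromBlocks P (R.submatrix id f) (R.submatrix id f)ᴴ (S.submatrix f f) := by
    ext (i | i) (j | j) <;> rfl
  have hp := h.submatrix (e := Sum.map id f) (Function.injective_id.sumMap hf)
  rw [e] at hp ⊢
  rw [hp.schur_complement.2.2]
  congr 2

/-- Koteljanskii's inequality: the logarithm of the determinant is submodular on the principal
submatrices of a positive definite matrix. It is Fischer's inequality for the Schur complement of
the common block. -/
theorem PosDef.det_mul_det_le {M : Matrix (β ⊕ (α ⊕ γ)) (β ⊕ (α ⊕ γ)) ℂ} (h : M.PosDef) :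
    M.det * (M.submatrix Sum.inl Sum.inl).det ≤
      (M.submatrix (Sum.map id Sum.inl) (Sum.map id Sum.inl) : Matrix (β ⊕ α) (β ⊕ α) ℂ).det *
      (M.submatrix (Sum.map id Sum.inr) (Sum.map id Sum.inr) : Matrix (β ⊕ γ) (β ⊕ γ) ℂ).det := by
  obtain ⟨P, R, R', S, rfl⟩ : ∃ P R R' S, M = fromBlocks P R R' S :=
    ⟨_, _, _, _, (fromBlocks_toBlocks M).symm⟩
  obtain rfl : Rᴴ = R' := by
    have := h.isHermitian
    rw [IsHermitian, fromBlocks_conjTranspose, fromBlocks_inj] at this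
    exact this.2.2.1
  obtain ⟨hP, hS, hd⟩ := h.schur_complement
  set N := S - Rᴴ * P⁻¹ * R with hN
  have e0 : (fromBlocks P R Rᴴ S).submatrix Sum.inl Sum.inl = P := rfl
  rw [h.det_submatrix_sum_map Sum.inl_injective, h.det_submatrix_sum_map Sum.inr_injective, hd,
    e0, ← hN]
  have eN : N = fromBlocks (N.submatrix Sum.inl Sum.inl) (N.submatrix Sum.inl Sum.inr)
      (N.submatrix Sum.inl Sum.inr)ᴴ (N.submatrix Sum.inr Sum.inr) := by
    conv_lhs => rw [← fromBlocks_toBlocks N]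
    congr 1
    ext i j
    exact (hS.isHermitian.apply _ _).symm
  have hF := hS
  rw [eN] at hF
  have hF' := hF.det_fromBlocks_le
  rw [← eN] at hF'
  calc P.det * N.det * P.det = (P.det * P.det) * N.det := by ring
    _ ≤ (P.det * P.det) * _ := mul_le_mul_of_nonneg_left hF' (mul_pos hP.det_pos hP.det_pos).le
    _ = _ := by ring

end Determinants
end Matrix

/-! ### Strong subadditivity of `tr (-M log M)` -/

/-- A signed sum of `x log x` is nonnegative as soon as the signed sums of `log (s + x)` are
nonpositive for all `s > 0`, provided that the signs balance the number of points and their sum: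
with `φ x = x log x - x` the function `s ↦ ∑ w φ (s + x)` decreases and tends to `0`. -/
theorem sum_mul_log_nonneg_of_sum_log_nonpos {J : Type*} [Fintype J] {w x : J → ℝ}
    (hx : ∀ j, 0 ≤ x j) (hw : ∑ j, w j = 0) (hwx : ∑ j, w j * x j = 0)
    (hlog : ∀ s : ℝ, 0 < s → ∑ j, w j * Real.log (s + x j) ≤ 0) :
    0 ≤ ∑ j, w j * (x j * Real.log (x j)) := by
  set G : ℝ → ℝ := fun s => ∑ j, w j * ((s + x j) * Real.log (s + x j) - (s + x j)) with hG
  have hcont : Continuous G := by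
    refine continuous_finsetSum _ fun j _ => ?_
    have : Continuous fun s : ℝ => s + x j := by fun_prop
    exact continuous_const.mul ((Real.continuous_mul_log.comp this).sub this)
  have hderiv : ∀ s : ℝ, 0 < s → HasDerivAt G (∑ j, w j * Real.log (s + x j)) s := by
    intro s hs
    refine HasDerivAt.fun_sum fun j _ => ?_
    have h1 : HasDerivAt (fun s : ℝ => s + x j) 1 s := (hasDerivAt_id s).add_const _
    have h2 := (Real.hasDerivAt_mul_log (x := s + x j)
      (by linarith [hx j] : 0 < s + x j).ne').comp s h1
    convert! (h2.sub h1).const_mul (w j) using 1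
    ring
  have hanti : AntitoneOn G (Set.Ici 0) := by
    refine antitoneOn_of_deriv_nonpos (convex_Ici 0) hcont.continuousOn ?_ ?_
    · intro s hs
      rw [interior_Ici] at hs
      exact (hderiv s hs).differentiableAt.differentiableWithinAt
    · intro s hs
      rw [interior_Ici] at hs
      rw [(hderiv s hs).deriv]
      exact hlog s hs
  have hlim : Tendsto G atTop (𝓝 0) := by
    have h1 : Tendsto (fun s : ℝ => ∑ j, w j * (s * Real.log (1 + x j / s)
        + x j * Real.log (1 + x j / s))) atTop (𝓝 (∑ j, w j * (x j + x j * 0))) := by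
      refine tendsto_finsetSum _ fun j _ => Tendsto.const_mul _ (Tendsto.add ?_ ?_)
      · exact Real.tendsto_mul_log_one_add_div_atTop (x j)
      · refine Tendsto.const_mul _ ?_
        have : Tendsto (fun s : ℝ => 1 + x j / s) atTop (𝓝 (1 + 0)) :=
          tendsto_const_nhds.add (tendsto_const_nhds.div_atTop tendsto_id)
        rw [add_zero] at this
        simpa using this.log one_ne_zero
    have h0 : ∑ j, w j * (x j + x j * 0) = 0 := by simpa using hwx
    rw [h0] at h1
    refine h1.congr' ?_
    filter_upwards [eventually_gt_atTop 0] with s hs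
    have e : ∀ j, w j * ((s + x j) * Real.log (s + x j) - (s + x j)) =
        w j * (s * Real.log (1 + x j / s) + x j * Real.log (1 + x j / s))
        + (w j * s + w j * x j) * (Real.log s - 1) := by
      intro j
      have : Real.log (s + x j) = Real.log s + Real.log (1 + x j / s) := by
        rw [← Real.log_mul hs.ne' (by have := div_nonneg (hx j) hs.le; positivity)]
        congr 1; field_simp
      rw [this]; ring
    simp only [hG, e]
    rw [Finset.sum_add_distrib, ← Finset.sum_mul, Finset.sum_add_distrib, ← Finset.sum_mul, hw, hwx]
    ring
  have h0 : 0 ≤ G 0 := by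
    refine le_of_tendsto hlim ?_
    filter_upwards [eventually_ge_atTop 0] with s hs
    exact hanti Set.self_mem_Ici hs hs
  have : G 0 = ∑ j, w j * (x j * Real.log (x j)) := by
    simp only [hG, zero_add, mul_sub, Finset.sum_sub_distrib, hwx, sub_zero]
  rwa [← this]

namespace Matrix

variable {ι κ : Type*} [Fintype ι] [DecidableEq ι] [Fintype κ] [DecidableEq κ]

theorem IsHermitian.trace_cfc {M : Matrix ι ι ℂ} (hM : M.IsHermitian) (f : ℝ → ℝ) :
    (cfc f M).trace = ∑ i, (f (hM.eigenvalues i) : ℂ) := by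
  rw [hM.cfc_eq, IsHermitian.cfc, Unitary.conjStarAlgAut_apply, trace_mul_cycle]
  simp [trace_diagonal]

/-- The trace of a function of a Hermitian matrix depends only on the characteristic polynomial,
hence not on the labelling of the basis. -/
theorem IsHermitian.trace_cfc_eq_sum_roots {M : Matrix ι ι ℂ} (hM : M.IsHermitian) (f : ℝ → ℝ) :
    (cfc f M).trace = (M.charpoly.roots.map fun z => (f z.re : ℂ)).sum := by
  rw [hM.trace_cfc, hM.roots_charpoly_eq_eigenvalues, Multiset.map_map]
  rfl

theorem IsHermitian.trace_cfc_submatrix {M : Matrix ι ι ℂ} (hM : M.IsHermitian) (f : ℝ → ℝ)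
    (e : κ ≃ ι) : (cfc f (M.submatrix e e)).trace = (cfc f M).trace := by
  rw [(hM.submatrix e).trace_cfc_eq_sum_roots, hM.trace_cfc_eq_sum_roots]
  congr 3
  exact charpoly_reindex e.symm M

theorem PosSemidef.log_det_smul_one_add {M : Matrix ι ι ℂ} (hM : M.PosSemidef) {s : ℝ}
    (hs : 0 < s) : Real.log ((s : ℂ) • (1 : Matrix ι ι ℂ) + M).det.re =
      ∑ i, Real.log (s + hM.1.eigenvalues i) := by
  rw [hM.1.det_smul_one_add, ← Complex.ofReal_prod, Complex.ofReal_re, Real.log_prod]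
  intro i _
  linarith [hM.eigenvalues_nonneg i]

theorem PosSemidef.posDef_smul_one_add {ι : Type*} [DecidableEq ι] {M : Matrix ι ι ℂ}
    (hM : M.PosSemidef) {s : ℝ} (hs : 0 < s) : ((s : ℂ) • (1 : Matrix ι ι ℂ) + M).PosDef :=
  (PosDef.one.smul (by exact_mod_cast hs)).add_posSemidef hM

theorem smul_one_add_submatrix {ι κ : Type*} [DecidableEq ι] [DecidableEq κ] (M : Matrix ι ι ℂ)
    (s : ℂ) {f : κ → ι} (hf : f.Injective) :
    (s • (1 : Matrix ι ι ℂ) + M).submatrix f f = s • (1 : Matrix κ κ ℂ) + M.submatrix f f := by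
  ext i j
  simp [one_apply, hf.eq_iff]

variable {α β γ : Type*} [Fintype α] [DecidableEq α] [Fintype β] [DecidableEq β]
  [Fintype γ] [DecidableEq γ]

/-- Strong subadditivity: the functional `M ↦ tr (-M log M)` is submodular on the principal
submatrices of a positive semidefinite matrix. -/
theorem PosSemidef.trace_negMulLog_submodular {M : Matrix (β ⊕ (α ⊕ γ)) (β ⊕ (α ⊕ γ)) ℂ}
    (h : M.PosSemidef) :
    (cfc Real.negMulLog M).trace.re + (cfc Real.negMulLog (M.submatrix Sum.inl Sum.inl)).trace.re ≤
      (cfc Real.negMulLog (M.submatrix (Sum.map id Sum.inl) (Sum.map id Sum.inl) :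
        Matrix (β ⊕ α) (β ⊕ α) ℂ)).trace.re +
      (cfc Real.negMulLog (M.submatrix (Sum.map id Sum.inr) (Sum.map id Sum.inr) :
        Matrix (β ⊕ γ) (β ⊕ γ) ℂ)).trace.re := by
  set M₀ := M.submatrix Sum.inl Sum.inl with hM₀
  set M₁ : Matrix (β ⊕ α) (β ⊕ α) ℂ :=
    M.submatrix (Sum.map id Sum.inl) (Sum.map id Sum.inl) with hM₁
  set M₂ : Matrix (β ⊕ γ) (β ⊕ γ) ℂ :=
    M.submatrix (Sum.map id Sum.inr) (Sum.map id Sum.inr) with hM₂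
  have h₀ : M₀.PosSemidef := h.submatrix _
  have h₁ : M₁.PosSemidef := h.submatrix _
  have h₂ : M₂.PosSemidef := h.submatrix _
  -- the signed spectrum: plus for the whole and the overlap, minus for the two overlapping parts
  let w : ((β ⊕ (α ⊕ γ)) ⊕ β) ⊕ ((β ⊕ α) ⊕ (β ⊕ γ)) → ℝ := Sum.elim (fun _ => 1) (fun _ => -1)
  let x : ((β ⊕ (α ⊕ γ)) ⊕ β) ⊕ ((β ⊕ α) ⊕ (β ⊕ γ)) → ℝ :=
    Sum.elim (Sum.elim h.1.eigenvalues h₀.1.eigenvalues)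
      (Sum.elim h₁.1.eigenvalues h₂.1.eigenvalues)
  have hsum : ∀ f : ℝ → ℝ, ∑ j, w j * f (x j) =
      (∑ i, f (h.1.eigenvalues i) + ∑ i, f (h₀.1.eigenvalues i)) -
      (∑ i, f (h₁.1.eigenvalues i) + ∑ i, f (h₂.1.eigenvalues i)) := by
    intro f
    rw [Fintype.sum_sum_type, Fintype.sum_sum_type (f := fun j => w (Sum.inl j) * _),
      Fintype.sum_sum_type (f := fun j => w (Sum.inr j) * _)]
    simp only [w, x, Sum.elim_inl, Sum.elim_inr, one_mul, neg_mul, Finset.sum_neg_distrib]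
    ring
  have key := sum_mul_log_nonneg_of_sum_log_nonpos (w := w) (x := x) ?_ ?_ ?_ ?_
  · rw [hsum fun t => t * Real.log t] at key
    rw [h.1.trace_cfc, h₀.1.trace_cfc, h₁.1.trace_cfc, h₂.1.trace_cfc]
    simp only [Real.negMulLog, ← Complex.ofReal_sum, Complex.ofReal_re, neg_mul,
      Finset.sum_neg_distrib]
    linarith
  · rintro ((i | i) | (i | i))
    exacts [h.eigenvalues_nonneg i, h₀.eigenvalues_nonneg i, h₁.eigenvalues_nonneg i,
      h₂.eigenvalues_nonneg i]
  · have := hsum fun _ => 1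
    simp only [mul_one] at this
    rw [this]
    simp
    ring
  · rw [hsum fun t => t]
    have h3 : M.trace + M₀.trace = M₁.trace + M₂.trace := by
      simp only [trace, Fintype.sum_sum_type, diag_apply, hM₀, hM₁, hM₂, submatrix_apply,
        Sum.map_inl, Sum.map_inr, id]
      ring
    have := congrArg Complex.re h3
    rw [h.1.trace_eq_sum_eigenvalues, h₀.1.trace_eq_sum_eigenvalues,
      h₁.1.trace_eq_sum_eigenvalues, h₂.1.trace_eq_sum_eigenvalues] at this
    simp only [Complex.add_re, Complex.re_sum, RCLike.ofReal_eq_complex_ofReal,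
      Complex.ofReal_re] at this
    linarith
  · intro s hs
    rw [hsum fun t => Real.log (s + t)]
    rw [← h.log_det_smul_one_add hs, ← h₀.log_det_smul_one_add hs, ← h₁.log_det_smul_one_add hs,
      ← h₂.log_det_smul_one_add hs]
    have hp := h.posDef_smul_one_add hs
    have hp₀ := h₀.posDef_smul_one_add hs
    have hp₁ := h₁.posDef_smul_one_add hs
    have hp₂ := h₂.posDef_smul_one_add hs
    have hk := hp.det_mul_det_le
    rw [smul_one_add_submatrix _ _ Sum.inl_injective, smul_one_add_submatrix _ _
      (Function.injective_id.sumMap Sum.inl_injective), smul_one_add_submatrix _ _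
      (Function.injective_id.sumMap Sum.inr_injective)] at hk
    obtain ⟨r, hr, e⟩ := RCLike.pos_iff_exists_ofReal.mp hp.det_pos
    obtain ⟨r₀, hr₀, e₀⟩ := RCLike.pos_iff_exists_ofReal.mp hp₀.det_pos
    obtain ⟨r₁, hr₁, e₁⟩ := RCLike.pos_iff_exists_ofReal.mp hp₁.det_pos
    obtain ⟨r₂, hr₂, e₂⟩ := RCLike.pos_iff_exists_ofReal.mp hp₂.det_pos
    rw [← e, ← e₀, ← e₁, ← e₂] at hk
    simp only [RCLike.ofReal_eq_complex_ofReal, ← Complex.ofReal_mul, Complex.real_le_real] at hk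
    rw [← e, ← e₀, ← e₁, ← e₂]
    simp only [RCLike.ofReal_eq_complex_ofReal, Complex.ofReal_re]
    rw [← Real.log_mul hr.ne' hr₀.ne', ← Real.log_mul hr₁.ne' hr₂.ne', sub_nonpos]
    exact Real.log_le_log (mul_pos hr hr₀) hk

end Matrix

/-! ### Entropy of symbols -/

section Symbols
variable {ι κ : Type*} [Fintype ι] [DecidableEq ι] [Fintype κ] [DecidableEq κ]

theorem IsSymbol.isHermitian {Q : Matrix ι ι ℂ} (hQ : IsSymbol Q) : Q.IsHermitian := hQ.1.1

theorem IsSymbol.eigenvalues_mem_Icc {Q : Matrix ι ι ℂ} (hQ : IsSymbol Q) (i : ι) :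
    hQ.isHermitian.eigenvalues i ∈ Set.Icc (0 : ℝ) 1 := by
  refine ⟨hQ.1.eigenvalues_nonneg i, ?_⟩
  have h1 := hQ.isHermitian.mulVec_eigenvectorBasis i
  have h2 := hQ.2.re_dotProduct_nonneg (hQ.isHermitian.eigenvectorBasis i)
  have h3 : star ((hQ.isHermitian.eigenvectorBasis i).ofLp) ⬝ᵥ
      ((hQ.isHermitian.eigenvectorBasis i).ofLp) = 1 := by
    have := (hQ.isHermitian.eigenvectorBasis).orthonormal.1 i
    rw [dotProduct_comm, ← EuclideanSpace.inner_eq_star_dotProduct, inner_self_eq_norm_sq_to_K,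
      this]
    simp
  rw [Matrix.sub_mulVec, h1, Matrix.one_mulVec, dotProduct_sub, dotProduct_smul, h3] at h2
  simpa using h2

theorem symbolEntropy_eq_add {Q : Matrix ι ι ℂ} (hQ : Q.IsHermitian) :
    symbolEntropy Q = (cfc Real.negMulLog Q).trace.re + (cfc Real.negMulLog (1 - Q)).trace.re := by
  have h : ∀ {M : Matrix ι ι ℂ}, M.IsHermitian → M * cfc Real.log M = -cfc Real.negMulLog M := by
    intro M hM
    have hc : ∀ f : ℝ → ℝ, ContinuousOn f (spectrum ℝ M) := fun f =>
      M.finite_real_spectrum.continuousOn f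
    have hs : IsSelfAdjoint M := hM
    rw [← cfc_neg]
    nth_rewrite 1 [← cfc_id' ℝ M]
    rw [← cfc_mul _ _ M (hc _) (hc _)]
    simp [Real.negMulLog]
  rw [symbolEntropy, h hQ, h (Matrix.isHermitian_one.sub hQ), ← neg_add, Matrix.trace_neg]
  simp

theorem symbolEntropy_eq_sum_binEntropy {Q : Matrix ι ι ℂ} (hQ : Q.IsHermitian) :
    symbolEntropy Q = ∑ i, Real.binEntropy (hQ.eigenvalues i) := by
  have hc : ∀ f : ℝ → ℝ, ContinuousOn f (spectrum ℝ Q) := fun f =>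
      Q.finite_real_spectrum.continuousOn f
  have hs : IsSelfAdjoint Q := hQ
  have h1 : (1 - Q) = cfc (fun x : ℝ => 1 - x) Q := by
    rw [cfc_sub _ _ Q, cfc_const_one ℝ Q, cfc_id' ℝ Q]
  rw [symbolEntropy_eq_add hQ, h1, ← cfc_comp' _ _ _ (by fun_prop) , hQ.trace_cfc, hQ.trace_cfc,
    Real.binEntropy_eq_negMulLog_add_negMulLog_one_sub']
  simp [Finset.sum_add_distrib]

theorem symbolEntropy_submatrix {Q : Matrix ι ι ℂ} (hQ : Q.IsHermitian) (e : κ ≃ ι) :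
    symbolEntropy (Q.submatrix e e) = symbolEntropy Q := by
  rw [symbolEntropy_eq_add hQ, symbolEntropy_eq_add (hQ.submatrix e), hQ.trace_cfc_submatrix]
  have : 1 - Q.submatrix e e = (1 - Q).submatrix e e := by simp [Matrix.submatrix_sub]
  rw [this, (Matrix.isHermitian_one.sub hQ).trace_cfc_submatrix]

variable {α β γ : Type*} [Fintype α] [DecidableEq α] [Fintype β] [DecidableEq β]
  [Fintype γ] [DecidableEq γ]

/-- Strong subadditivity of the entropy of symbols. -/
theorem IsSymbol.entropy_submodular {M : Matrix (β ⊕ (α ⊕ γ)) (β ⊕ (α ⊕ γ)) ℂ} (h : IsSymbol M) :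
    symbolEntropy M + symbolEntropy (M.submatrix Sum.inl Sum.inl) ≤
      symbolEntropy (M.submatrix (Sum.map id Sum.inl) (Sum.map id Sum.inl) :
        Matrix (β ⊕ α) (β ⊕ α) ℂ) +
      symbolEntropy (M.submatrix (Sum.map id Sum.inr) (Sum.map id Sum.inr) :
        Matrix (β ⊕ γ) (β ⊕ γ) ℂ) := by
  have h1 := h.1.trace_negMulLog_submodular
  have h2 := h.2.trace_negMulLog_submodular
  have hH := h.isHermitian
  simp only [Matrix.submatrix_sub, Pi.sub_apply, Matrix.submatrix_one _ Sum.inl_injective,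
    Matrix.submatrix_one _ (Function.injective_id.sumMap Sum.inl_injective),
    Matrix.submatrix_one _ (Function.injective_id.sumMap Sum.inr_injective)] at h2
  rw [symbolEntropy_eq_add hH, symbolEntropy_eq_add (hH.submatrix _),
    symbolEntropy_eq_add (hH.submatrix _), symbolEntropy_eq_add (hH.submatrix _)]
  linarith

end Symbols

/-! ### Concave sequences and Riemann sums -/

/-- If the increments of `u ≥ 0` decrease and `u n / n` converges, the increments converge to the
same limit. -/
theorem tendsto_sub_of_tendsto_div {u : ℕ → ℝ} {L : ℝ} (h0 : ∀ n, 0 ≤ u n)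
    (hu : ∀ n, u (n + 2) + u n ≤ u (n + 1) + u (n + 1))
    (hL : Tendsto (fun n : ℕ => u (n + 1) / ((n : ℝ) + 1)) atTop (𝓝 L)) :
    Tendsto (fun n => u (n + 1) - u n) atTop (𝓝 L) := by
  set a : ℕ → ℝ := fun n => u (n + 1) - u n with ha
  have hanti : Antitone a := antitone_nat_of_succ_le fun n => by
    simp only [ha]; linarith [hu n]
  have hsum : ∀ n, ∑ i ∈ Finset.range n, a i = u n - u 0 := fun n => Finset.sum_range_sub u n
  have hnn : ∀ n, 0 ≤ a n := by
    intro n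
    by_contra! hn
    have hb : ∀ k : ℕ, u (n + k) ≤ u n + k * a n := by
      intro k
      induction k with
      | zero => simp
      | succ k ih =>
        have := hanti (Nat.le_add_right n k)
        simp only [ha] at this ih ⊢
        push_cast
        rw [← add_assoc]
        linarith
    obtain ⟨k, hk⟩ := exists_nat_gt (u n / (-a n))
    rw [div_lt_iff₀ (by linarith)] at hk
    linarith [hb k, h0 (n + k)]
  obtain ⟨l, hl⟩ : ∃ l, Tendsto a atTop (𝓝 l) :=
    ⟨_, tendsto_atTop_ciInf hanti ⟨0, by rintro _ ⟨n, rfl⟩; exact hnn n⟩⟩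
  have hc := (hl.cesaro).comp (tendsto_add_atTop_nat 1)
  have h2 : Tendsto (fun n : ℕ => u 0 / ((n : ℝ) + 1)) atTop (𝓝 0) :=
    tendsto_const_nhds.div_atTop (tendsto_atTop_add_const_right _ _ tendsto_natCast_atTop_atTop)
  have h3 := hL.sub h2
  rw [sub_zero] at h3
  have : L = l := by
    refine tendsto_nhds_unique h3 (hc.congr fun n => ?_)
    simp only [Function.comp, hsum]
    push_cast
    field_simp
  rwa [this]

/-- Convergence of Riemann sums at equidistant nodes. -/
theorem tendsto_riemannSum {f : ℝ → ℂ} (hf : Continuous f) :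
    Tendsto (fun n : ℕ => (1 / (n : ℂ)) * ∑ l ∈ Finset.range n, f (2 * Real.pi * l / n)) atTop
      (𝓝 ((1 / (2 * Real.pi) : ℂ) * ∫ θ in (0 : ℝ)..(2 * Real.pi), f θ)) := by
  have hpi := Real.pi_pos
  rw [Metric.tendsto_atTop]
  intro ε hε
  have huc := isCompact_Icc.uniformContinuousOn_of_continuous
    (hf.continuousOn (s := Set.Icc 0 (2 * Real.pi)))
  rw [Metric.uniformContinuousOn_iff] at huc
  obtain ⟨δ, hδ, huc⟩ := huc (ε / 2) (by positivity)
  obtain ⟨N, hN⟩ := exists_nat_gt (2 * Real.pi / δ)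
  refine ⟨N + 1, fun n hn => ?_⟩
  have hn0 : (0 : ℝ) < n := by exact_mod_cast (by omega : 0 < n)
  have hnδ : 2 * Real.pi / n < δ := by
    have : (N : ℝ) ≤ n := by exact_mod_cast (by omega : N ≤ n)
    rw [div_lt_iff₀ hδ] at hN
    rw [div_lt_iff₀ hn0]
    nlinarith
  set p : ℕ → ℝ := fun l => 2 * Real.pi * l / n with hp
  have hpn : p n = 2 * Real.pi := by simp only [hp]; field_simp
  have hp0 : p 0 = 0 := by simp [hp]
  have hps : ∀ l, p (l + 1) - p l = 2 * Real.pi / n := by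
    intro l; simp only [hp]; push_cast; ring
  have hint : ∫ θ in (0 : ℝ)..(2 * Real.pi), f θ =
      ∑ l ∈ Finset.range n, ∫ θ in (p l)..(p (l + 1)), f θ := by
    rw [intervalIntegral.sum_integral_adjacent_intervals
      fun k _ => hf.intervalIntegrable _ _, hp0, hpn]
  have hstep : ∀ l ∈ Finset.range n,
      ‖(2 * Real.pi / n : ℝ) * f (p l) - ∫ θ in (p l)..(p (l + 1)), f θ‖
        ≤ ε / 2 * (2 * Real.pi / n) := by
    intro l hl
    have h1 : ((2 * Real.pi / n : ℝ) : ℂ) * f (p l) = ∫ _ in (p l)..(p (l + 1)), f (p l) := by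
      rw [intervalIntegral.integral_const, hps, Complex.real_smul]
    rw [h1, ← intervalIntegral.integral_sub (by simp) (hf.intervalIntegrable _ _)]
    refine (intervalIntegral.norm_integral_le_of_norm_le_const (C := ε / 2) ?_).trans ?_
    · intro θ hθ
      have hle : p l ≤ p (l + 1) := by
        have := hps l; have h2 : 0 ≤ 2 * Real.pi / n := by positivity
        linarith
      rw [Set.uIoc_of_le hle] at hθ
      have hl0 : 0 ≤ p l := by simp only [hp]; positivity
      have hl1 : p (l + 1) ≤ 2 * Real.pi := by
        simp only [hp]
        rw [div_le_iff₀ hn0]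
        have : ((l + 1 : ℕ) : ℝ) ≤ n := by
          exact_mod_cast Nat.succ_le_of_lt (Finset.mem_range.mp hl)
        nlinarith
      rw [← dist_eq_norm]
      refine (huc _ ⟨hl0, hle.trans hl1⟩ _ ⟨hl0.trans hθ.1.le, hθ.2.trans hl1⟩ ?_).le
      rw [dist_comm, Real.dist_eq, abs_of_pos (by linarith [hθ.1])]
      linarith [hθ.2, hps l]
    · rw [hps, abs_of_pos (by positivity)]
  have e : (1 / (n : ℂ)) * ∑ l ∈ Finset.range n, f (p l) -
      (1 / (2 * Real.pi) : ℂ) * ∫ θ in (0 : ℝ)..(2 * Real.pi), f θ =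
      ((1 / (2 * Real.pi) : ℝ) : ℂ) * ∑ l ∈ Finset.range n,
        ((2 * Real.pi / n : ℝ) * f (p l) - ∫ θ in (p l)..(p (l + 1)), f θ) := by
    rw [hint, Finset.sum_sub_distrib, ← Finset.mul_sum, mul_sub]
    congr 1
    · rw [← mul_assoc]
      congr 1
      push_cast
      have : (Real.pi : ℂ) ≠ 0 := by exact_mod_cast hpi.ne'
      field_simp
    · push_cast; rfl
  rw [dist_eq_norm, e, norm_mul, Complex.norm_real, Real.norm_of_nonneg (by positivity)]
  calc 1 / (2 * Real.pi) * _ ≤ 1 / (2 * Real.pi) * (n * (ε / 2 * (2 * Real.pi / n))) := by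
        gcongr
        refine (norm_sum_le_of_le _ hstep).trans ?_
        simp
    _ = ε / 2 := by field_simp
    _ < ε := by linarith

/-! ### Trace estimates and polynomial approximation of the entropy -/

section TraceEstimates
open scoped Matrix.Norms.L2Operator MatrixOrder

variable {ι κ : Type*} [Fintype ι] [DecidableEq ι] [Fintype κ] [DecidableEq κ]

theorem IsSymbol.norm_le_one {Q : Matrix ι ι ℂ} (hQ : IsSymbol Q) : ‖Q‖ ≤ 1 :=
  (CStarAlgebra.norm_le_one_iff_of_nonneg Q hQ.1.nonneg).mpr hQ.2

theorem Matrix.norm_entry_le_l2_opNorm {ι : Type*} [Fintype ι] (M : Matrix ι κ ℂ)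
    (i : ι) (j : κ) : ‖M i j‖ ≤ ‖M‖ := by
  have h := Matrix.l2_opNorm_mulVec M (EuclideanSpace.single j 1)
  have h2 := PiLp.norm_apply_le (WithLp.toLp 2 (M *ᵥ (EuclideanSpace.single j (1 : ℂ)).ofLp)) i
  simp at h h2
  exact h2.trans h

/-- Duality between the entrywise `ℓ¹` norm and the operator norm. -/
theorem Matrix.norm_trace_mul_le (E M : Matrix ι ι ℂ) :
    ‖(E * M).trace‖ ≤ (∑ i, ∑ j, ‖E i j‖) * ‖M‖ := by
  rw [trace, Finset.sum_mul]
  refine norm_sum_le_of_le _ fun i _ => ?_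
  rw [diag_apply, mul_apply, Finset.sum_mul]
  refine norm_sum_le_of_le _ fun j _ => ?_
  rw [norm_mul]
  exact mul_le_mul_of_nonneg_left (norm_entry_le_l2_opNorm M j i) (norm_nonneg _)

/-- The moments of two contractions differ by at most a multiple of the entrywise `ℓ¹` distance of
the matrices, whatever their size. -/
theorem Matrix.norm_trace_pow_sub_le {S T : Matrix ι ι ℂ} (hS : ‖S‖ ≤ 1) (hT : ‖T‖ ≤ 1) (m : ℕ) :
    ‖(S ^ m).trace - (T ^ m).trace‖ ≤ m * ∑ i, ∑ j, ‖(S - T) i j‖ := by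
  have key : ∀ (m : ℕ) (D : Matrix ι ι ℂ), ‖D‖ ≤ 1 →
      ‖((S ^ m - T ^ m) * D).trace‖ ≤ m * ∑ i, ∑ j, ‖(S - T) i j‖ := by
    intro m
    induction m with
    | zero => intro D _; simp
    | succ m ih =>
      intro D hD
      -- one telescoping step, the factor `S ^ m` being moved by cyclicity of the trace
      have e : ((S ^ (m + 1) - T ^ (m + 1)) * D).trace =
          ((S - T) * (D * S ^ m)).trace + ((S ^ m - T ^ m) * (T * D)).trace := by
        have : ((S - T) * (D * S ^ m)).trace = (S ^ m * ((S - T) * D)).trace := by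
          rw [← Matrix.mul_assoc, trace_mul_comm]
        rw [this, ← trace_add, pow_succ, pow_succ]
        congr 1
        noncomm_ring
      have hp : ‖S ^ m‖ ≤ 1 := by
        rcases isEmpty_or_nonempty ι with h | h
        · rw [Subsingleton.elim (S ^ m) 0]; simp
        · exact (norm_pow_le S m).trans (pow_le_one₀ (norm_nonneg _) hS)
      have h1 : ‖D * S ^ m‖ ≤ 1 :=
        (norm_mul_le _ _).trans (mul_le_one₀ hD (norm_nonneg _) hp)
      have h2 : ‖T * D‖ ≤ 1 := (norm_mul_le _ _).trans (mul_le_one₀ hT (norm_nonneg _) hD)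
      have hn : 0 ≤ ∑ i, ∑ j, ‖(S - T) i j‖ := by positivity
      rw [e]
      refine (norm_add_le _ _).trans ?_
      have := (norm_trace_mul_le (S - T) (D * S ^ m)).trans (mul_le_of_le_one_right hn h1)
      have := ih _ h2
      push_cast
      linarith
  rcases isEmpty_or_nonempty ι with h | h
  · simp [Matrix.trace]
  · have := key m 1 (by simp)
    rwa [mul_one, trace_sub] at this

theorem Matrix.trace_aeval_re (p : Polynomial ℝ) (M : Matrix ι ι ℂ) :
    (Polynomial.aeval M p).trace.re =
      ∑ m ∈ Finset.range (p.natDegree + 1), p.coeff m * (M ^ m).trace.re := by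
  rw [Polynomial.aeval_eq_sum_range, trace_sum, Complex.re_sum]
  simp [trace_smul]

theorem Matrix.abs_trace_aeval_sub_le (p : Polynomial ℝ) {S T : Matrix ι ι ℂ} (hS : ‖S‖ ≤ 1)
    (hT : ‖T‖ ≤ 1) :
    |(Polynomial.aeval S p).trace.re - (Polynomial.aeval T p).trace.re| ≤
      (∑ m ∈ Finset.range (p.natDegree + 1), |p.coeff m| * m) * ∑ i, ∑ j, ‖(S - T) i j‖ := by
  rw [trace_aeval_re, trace_aeval_re, ← Finset.sum_sub_distrib, Finset.sum_mul]
  refine (Finset.abs_sum_le_sum_abs _ _).trans (Finset.sum_le_sum fun m _ => ?_)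
  rw [← mul_sub, abs_mul, mul_assoc, ← Complex.sub_re]
  exact mul_le_mul_of_nonneg_left
    ((Complex.abs_re_le_norm _).trans (norm_trace_pow_sub_le hS hT m)) (abs_nonneg _)

/-- A polynomial uniformly close to the binary entropy on `[0, 1]` computes entropies of symbols up
to an error proportional to the number of modes. -/
theorem IsSymbol.abs_entropy_sub_le {Q : Matrix ι ι ℂ} (hQ : IsSymbol Q) {p : Polynomial ℝ} {ε : ℝ}
    (hp : ∀ x ∈ Set.Icc (0 : ℝ) 1, |p.eval x - Real.binEntropy x| ≤ ε) :
    |symbolEntropy Q - (Polynomial.aeval Q p).trace.re| ≤ Fintype.card ι * ε := by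
  have hs : IsSelfAdjoint Q := hQ.isHermitian
  have h : (Polynomial.aeval Q p).trace.re = ∑ i, p.eval (hQ.isHermitian.eigenvalues i) := by
    rw [← cfc_polynomial p Q, hQ.isHermitian.trace_cfc]
    simp
  rw [symbolEntropy_eq_sum_binEntropy hQ.isHermitian, h, ← Finset.sum_sub_distrib]
  refine (Finset.abs_sum_le_sum_abs _ _).trans ?_
  refine (Finset.sum_le_sum fun i _ => ?_).trans_eq (by simp : ∑ _ : ι, ε = Fintype.card ι * ε)
  rw [abs_sub_comm]
  exact hp _ (hQ.eigenvalues_mem_Icc i)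

theorem IsSymbol.entropy_nonneg {Q : Matrix ι ι ℂ} (hQ : IsSymbol Q) : 0 ≤ symbolEntropy Q := by
  rw [symbolEntropy_eq_sum_binEntropy hQ.isHermitian]
  exact Finset.sum_nonneg fun i _ => Real.binEntropy_nonneg (hQ.eigenvalues_mem_Icc i).1
    (hQ.eigenvalues_mem_Icc i).2

/-- The entropy of a continuous family of symbols is continuous: it is a uniform limit of traces of
polynomials. -/
theorem continuous_symbolEntropy {X : Type*} [TopologicalSpace X] {σ : X → Matrix ι ι ℂ}
    (hσ : Continuous σ) (hs : ∀ x, IsSymbol (σ x)) : Continuous fun x => symbolEntropy (σ x) := by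
  refine continuous_of_uniform_approx_of_continuous fun u hu => ?_
  obtain ⟨ε, hε, hu⟩ := Metric.mem_uniformity_dist.mp hu
  have hc : 0 < (Fintype.card ι : ℝ) + 1 := by positivity
  obtain ⟨p, hp⟩ := exists_polynomial_near_of_continuousOn 0 1 Real.binEntropy
    Real.binEntropy_continuous.continuousOn (ε / (Fintype.card ι + 1)) (by positivity)
  refine ⟨fun x => (Polynomial.aeval (σ x) p).trace.re, ?_, fun x => hu ?_⟩
  · simp only [Matrix.trace_aeval_re]
    exact continuous_finsetSum _ fun m _ =>
      continuous_const.mul (Complex.continuous_re.comp (hσ.pow m).matrix_trace)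
  · rw [Real.dist_eq]
    refine ((hs x).abs_entropy_sub_le fun y hy => (hp y hy).le).trans_lt ?_
    rw [mul_div_assoc', div_lt_iff₀ hc]
    nlinarith

end TraceEstimates

/-! ### Quasi-free maps and the marginals of the process -/

namespace FreeMap

variable {ι κ ι' κ' l : Type*}

theorem act_relabel [Fintype κ] (e : ι ≃ ι') (Γ : FreeMap ι κ) (Q : Matrix κ κ ℂ) :
    (Γ.relabel e).act Q = Matrix.reindex e e (Γ.act Q) := by
  ext i j
  simp [act, relabel, Matrix.mul_apply]

theorem act_comp [Fintype κ] [Fintype l] (Γ : FreeMap κ l) (Γ' : FreeMap ι κ) (Q : Matrix l l ℂ) :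
    (Γ.comp Γ').act Q = Γ'.act (Γ.act Q) := by
  simp only [act, comp, Matrix.conjTranspose_mul, Matrix.mul_add, Matrix.add_mul, Matrix.mul_assoc]
  abel

/-- Letting `Γ` act on the first half of a bipartite system multiplies the correlations by its
`A`-part. -/
theorem act_directSum_ident [Fintype κ] [Fintype κ'] [DecidableEq κ'] (Γ : FreeMap ι κ)
    (P : Matrix κ κ ℂ) (R : Matrix κ κ' ℂ) (R' : Matrix κ' κ ℂ) (S : Matrix κ' κ' ℂ) :
    (Γ.directSum (ident κ')).act (Matrix.fromBlocks P R R' S) =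
      Matrix.fromBlocks (Γ.act P) (Γ.Aᴴ * R) (R' * Γ.A) S := by
  simp [act, directSum, ident, Matrix.fromBlocks_conjTranspose, Matrix.fromBlocks_multiply,
    Matrix.fromBlocks_add]

variable [Fintype ι] [DecidableEq ι] [Fintype κ] [DecidableEq κ] [Fintype l]

theorem IsCP.act_isSymbol {Γ : FreeMap ι κ} (hΓ : Γ.IsCP) {Q : Matrix κ κ ℂ} (hQ : IsSymbol Q) :
    IsSymbol (Γ.act Q) := by
  refine ⟨(hQ.1.conjTranspose_mul_mul_same _).add hΓ.1, ?_⟩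
  have := (hQ.2.conjTranspose_mul_mul_same Γ.A).add hΓ.2
  convert this using 1
  simp only [act, Matrix.mul_sub, Matrix.sub_mul, Matrix.mul_one]
  abel

theorem isCP_ident : (ident ι).IsCP := by
  refine ⟨Matrix.PosSemidef.zero, ?_⟩
  simpa [ident] using Matrix.PosSemidef.zero

theorem IsCP.comp {Γ : FreeMap κ l} {Γ' : FreeMap ι κ} (h : Γ.IsCP) (h' : Γ'.IsCP) :
    (Γ.comp Γ').IsCP := by
  refine ⟨h'.1.add (h.1.conjTranspose_mul_mul_same _), ?_⟩
  have := (h.2.conjTranspose_mul_mul_same Γ'.A).add h'.2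
  convert this using 1
  simp only [FreeMap.comp, Matrix.conjTranspose_mul, Matrix.mul_sub, Matrix.sub_mul,
    Matrix.mul_assoc, Matrix.one_mul]
  abel

end FreeMap

theorem Matrix.PosSemidef.fromBlocks_diagonal {ι κ : Type*} [Fintype ι] [Fintype κ]
    {M : Matrix ι ι ℂ} {N : Matrix κ κ ℂ} (hM : M.PosSemidef) (hN : N.PosSemidef) :
    (Matrix.fromBlocks M 0 0 N).PosSemidef := by
  refine .of_dotProduct_mulVec_nonneg (hM.1.fromBlocks (by simp) hN.1) fun x => ?_
  rw [Matrix.fromBlocks_mulVec]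
  have h1 := hM.dotProduct_mulVec_nonneg (x ∘ Sum.inl)
  have h2 := hN.dotProduct_mulVec_nonneg (x ∘ Sum.inr)
  simp only [dotProduct, Fintype.sum_sum_type, Sum.elim_inl, Sum.elim_inr, zero_mulVec, add_zero,
    zero_add] at *
  exact add_nonneg h1 h2

namespace FreeMap
variable {ι κ ι' κ' : Type*} [Fintype ι] [DecidableEq ι] [Fintype κ] [Fintype ι'] [DecidableEq ι']
  [Fintype κ']

theorem IsCP.directSum {Γ : FreeMap ι κ} {Γ' : FreeMap ι' κ'} (h : Γ.IsCP) (h' : Γ'.IsCP) :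
    (Γ.directSum Γ').IsCP := by
  refine ⟨h.1.fromBlocks_diagonal h'.1, ?_⟩
  have := h.2.fromBlocks_diagonal h'.2
  convert this using 1
  simp only [FreeMap.directSum, Matrix.fromBlocks_conjTranspose, Matrix.fromBlocks_multiply]
  ext (i | i) (j | j) <;> simp [Matrix.one_apply]

theorem IsCP.relabel {Γ : FreeMap ι κ} (h : Γ.IsCP) (e : ι ≃ ι') : (Γ.relabel e).IsCP := by
  refine ⟨h.1.submatrix _, ?_⟩
  have := h.2.submatrix e.symm
  convert this using 1
  ext i j
  simp [FreeMap.relabel, Matrix.mul_apply, Matrix.one_apply]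

theorem IsCP.iterate {d : ℕ} {Λ : FreeMap (Fin d ⊕ Fin d) (Fin d)} (h : Λ.IsCP) :
    ∀ n, (Λ.iterate n).IsCP
  | 0 => isCP_ident.relabel _
  | n + 1 => (h.comp ((h.iterate n).directSum isCP_ident)).relabel _

end FreeMap

variable {d : ℕ}

theorem processMarginal_isSymbol {Λ : FreeMap (Fin d ⊕ Fin d) (Fin d)} (h : Λ.IsCP)
    {Q : Matrix (Fin d) (Fin d) ℂ} (hQ : IsSymbol Q) (n : ℕ) :
    IsSymbol (processMarginal Λ Q n) := by
  have := (h.iterate n).act_isSymbol hQ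
  refine ⟨this.1.submatrix Sum.inr, ?_⟩
  have h2 := this.2.submatrix Sum.inr
  rw [Matrix.submatrix_sub, Pi.sub_apply, Pi.sub_apply,
    Matrix.submatrix_one _ Sum.inr_injective] at h2
  exact h2

theorem appendSite_inl_inr {n : ℕ} (j : Fin n) (a : Fin d) :
    appendSite d n (.inl (.inr (j, a))) = .inr (j.castSucc, a) := rfl

theorem appendSite_inr {n : ℕ} (a : Fin d) : appendSite d n (.inr a) = .inr (Fin.last n, a) := rfl

/-- Site `j` of `n` is connected to the memory through `A ^ (n - j)`. -/
theorem iterate_A_inr (A B X : Matrix (Fin d) (Fin d) ℂ) (n : ℕ) (j : Fin n) (a b : Fin d) :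
    ((compatibleExtension A B X).iterate n).A a (.inr (j, b)) = (A ^ (n - j)) a b := by
  induction n generalizing a with
  | zero => exact j.elim0
  | succ n ih =>
    refine Fin.lastCases ?_ (fun j => ?_) j
    · have : ((compatibleExtension A B X).iterate (n + 1)).A a (.inr (Fin.last n, b)) =
          ((compatibleExtension A B X).comp (((compatibleExtension A B X).iterate n).directSum
            (FreeMap.ident (Fin d)))).A a (.inr b) := by
        rw [FreeMap.iterate, ← appendSite_inr]
        simp [FreeMap.relabel]
      rw [this]
      simp [FreeMap.comp, FreeMap.directSum, FreeMap.ident, compatibleExtension, Matrix.mul_apply,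
        Matrix.one_apply]
    · have : ((compatibleExtension A B X).iterate (n + 1)).A a (.inr (j.castSucc, b)) =
          ((compatibleExtension A B X).comp (((compatibleExtension A B X).iterate n).directSum
            (FreeMap.ident (Fin d)))).A a (.inl (.inr (j, b))) := by
        rw [FreeMap.iterate, ← appendSite_inl_inr]
        simp [FreeMap.relabel]
      rw [this, Fin.val_castSucc, Nat.succ_sub j.2.le, pow_succ']
      have hA : (compatibleExtension A B X).A = Matrix.fromCols A A := rfl
      simp [FreeMap.comp, FreeMap.directSum, FreeMap.ident, hA, Matrix.mul_apply, ih]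

/-- For the stationary symbol, one emission yields `Q` on both copies with correlation
`Y = Q - B + X`. -/
theorem act_compatibleExtension (A B X Q : Matrix (Fin d) (Fin d) ℂ) (hB : B.IsHermitian)
    (hQh : Q.IsHermitian) (hQ : (FreeMap.mk A B).act Q = Q) :
    (compatibleExtension A B X).act Q =
      Matrix.fromBlocks Q (Q - B + X) (Q - B + X)ᴴ Q := by
  have h : Aᴴ * Q * A = Q - B := eq_sub_of_add_eq hQ
  have hd : (Q - B + X)ᴴ = Q - B + Xᴴ := by
    rw [Matrix.conjTranspose_add, Matrix.conjTranspose_sub, hB.eq, hQh.eq]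
  rw [hd, FreeMap.act, compatibleExtension]
  ext (i | i) (j | j) <;>
  simp [Matrix.conjTranspose_fromCols_eq_fromRows_conjTranspose, Matrix.fromRows_mul, h]

/-- The `(j, k)` block of the Toeplitz matrix with `Q` on the diagonal, `A*ᵐ Y` on the `m`-th upper
diagonal and the adjoints below the diagonal. -/
def toeplitzBlock (A Q Y : Matrix (Fin d) (Fin d) ℂ) (j k : ℕ) : Matrix (Fin d) (Fin d) ℂ :=
  if j < k then Aᴴ ^ (k - j) * Y else if k < j then Yᴴ * A ^ (j - k) else Q

/-- The block Toeplitz matrix with `n × n` blocks `toeplitzBlock A Q Y`. -/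
def blockToeplitz (A Q Y : Matrix (Fin d) (Fin d) ℂ) (n : ℕ) :
    Matrix (Fin n × Fin d) (Fin n × Fin d) ℂ :=
  Matrix.of fun p q => toeplitzBlock A Q Y p.1 q.1 p.2 q.2

theorem processMarginal_eq_blockToeplitz (A B X Q : Matrix (Fin d) (Fin d) ℂ) (hB : B.IsHermitian)
    (hQh : Q.IsHermitian) (hQ : (FreeMap.mk A B).act Q = Q) (n : ℕ) :
    processMarginal (compatibleExtension A B X) Q n = blockToeplitz A Q (Q - B + X) n := by
  induction n with
  | zero => ext ⟨j, a⟩; exact j.elim0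
  | succ n ih =>
    set Λ := compatibleExtension A B X with hΛ
    set Y := Q - B + X with hY
    have hact : (Λ.iterate (n + 1)).act Q = Matrix.reindex (appendSite d n) (appendSite d n)
        (Matrix.fromBlocks ((Λ.iterate n).act Q) ((Λ.iterate n).Aᴴ * Y) (Yᴴ * (Λ.iterate n).A)
          Q) := by
      rw [FreeMap.iterate, FreeMap.act_relabel, FreeMap.act_comp, hΛ,
        act_compatibleExtension A B X Q hB hQh hQ, ← hΛ, ← hY, FreeMap.act_directSum_ident]
    have hentry : ∀ p q, (Λ.iterate (n + 1)).act Q (appendSite d n p) (appendSite d n q) =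
        Matrix.fromBlocks ((Λ.iterate n).act Q) ((Λ.iterate n).Aᴴ * Y) (Yᴴ * (Λ.iterate n).A) Q
          p q := by
      intro p q; rw [hact]; simp
    ext ⟨j, a⟩ ⟨k, b⟩
    have e : ∀ m p q, processMarginal Λ Q m p q = (Λ.iterate m).act Q (.inr p) (.inr q) :=
      fun _ _ _ => rfl
    rw [e]
    refine Fin.lastCases ?_ (fun j => ?_) j <;> refine Fin.lastCases ?_ (fun k => ?_) k
    · rw [← appendSite_inr, ← appendSite_inr, hentry]
      simp [blockToeplitz, toeplitzBlock]
    · rw [← appendSite_inr, ← appendSite_inl_inr, hentry]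
      simp [blockToeplitz, toeplitzBlock, Matrix.mul_apply, iterate_A_inr, hΛ,
        (Fin.castSucc_lt_last k).not_gt]
    · rw [← appendSite_inr, ← appendSite_inl_inr, hentry]
      simp [blockToeplitz, toeplitzBlock, Matrix.mul_apply, iterate_A_inr, Fin.castSucc_lt_last, hΛ,
        ← Matrix.conjTranspose_pow]
    · rw [← appendSite_inl_inr, ← appendSite_inl_inr, hentry, Matrix.fromBlocks_apply₁₁, ← e, ih]
      simp [blockToeplitz, toeplitzBlock]

/-! ### The Toeplitz symbol -/

theorem one_sub_compatibleExtension {d : ℕ} (A B X : Matrix (Fin d) (Fin d) ℂ) :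
    1 - (compatibleExtension A B X).Aᴴ * (compatibleExtension A B X).A -
      (compatibleExtension A B X).B =
    Matrix.fromBlocks (1 - Aᴴ * A - B) (-(Aᴴ * A) - X) (-(Aᴴ * A) - X)ᴴ (1 - Aᴴ * A - B) := by
  ext (i | i) (j | j) <;>
  simp [compatibleExtension, Matrix.conjTranspose_fromCols_eq_fromRows_conjTranspose,
    Matrix.one_apply]

section Contraction
open scoped Matrix.Norms.L2Operator MatrixOrder

variable {d : ℕ} {A B X Q : Matrix (Fin d) (Fin d) ℂ}

/-- Emitting two identically coupled copies forces `2 A* A ≤ 1`: compress both positivity conditions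
to the symmetric subspace. -/
theorem norm_lt_one_of_isCP (hΛ : (compatibleExtension A B X).IsCP) : ‖A‖ < 1 := by
  have h1 := hΛ.1.conjTranspose_mul_mul_same (Matrix.fromRows (1 : Matrix (Fin d) (Fin d) ℂ) 1)
  have h2 := hΛ.2.conjTranspose_mul_mul_same (Matrix.fromRows (1 : Matrix (Fin d) (Fin d) ℂ) 1)
  rw [one_sub_compatibleExtension] at h2
  simp only [compatibleExtension, Matrix.conjTranspose_fromRows_eq_fromCols_conjTranspose,
    Matrix.conjTranspose_one, Matrix.fromCols_mul_fromBlocks, Matrix.fromCols_mul_fromRows,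
    Matrix.one_mul, Matrix.mul_one] at h1 h2
  have h3 : ((2 : ℝ) • (1 - (2 : ℝ) • (Aᴴ * A))).PosSemidef := by
    convert h1.add h2 using 1
    simp only [Matrix.conjTranspose_sub, Matrix.conjTranspose_neg, Matrix.conjTranspose_mul,
      Matrix.conjTranspose_conjTranspose, two_smul]
    abel
  have h4 : (1 - (2 : ℝ) • (Aᴴ * A)).PosSemidef := by
    have := h3.smul (show (0 : ℝ) ≤ 1 / 2 by norm_num)
    rwa [smul_smul, show (1 / 2 : ℝ) * 2 = 1 by norm_num, one_smul] at this
  have h5 : ‖(2 : ℝ) • (Aᴴ * A)‖ ≤ 1 :=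
    (CStarAlgebra.norm_le_one_iff_of_nonneg _
      ((Matrix.posSemidef_conjTranspose_mul_self A).smul (by norm_num : (0 : ℝ) ≤ 2)).nonneg).mpr h4
  rw [norm_smul, Matrix.l2_opNorm_conjTranspose_mul_self, Real.norm_of_nonneg (by norm_num)] at h5
  nlinarith [norm_nonneg A]

/-- The solution of `Q = A* Q A + B` is the limit of the positive matrices `Q - A*ⁿ Q Aⁿ`. -/
theorem Matrix.posSemidef_of_fixed (hA : ‖A‖ < 1) (hB : B.PosSemidef) (hQ : Aᴴ * Q * A + B = Q) :
    Q.PosSemidef := by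
  have h : ∀ n : ℕ, (Q - (Aᴴ) ^ n * Q * A ^ n).PosSemidef := by
    intro n
    induction n with
    | zero => simpa using Matrix.PosSemidef.zero
    | succ n ih =>
      have := (ih.conjTranspose_mul_mul_same A).add hB
      convert this using 1
      conv_lhs => enter [1]; rw [← hQ]
      rw [pow_succ', pow_succ]
      noncomm_ring
  have hA' : ‖Aᴴ‖ < 1 := by rwa [Matrix.l2_opNorm_conjTranspose]
  have hlim : Tendsto (fun n : ℕ => Q - (Aᴴ) ^ n * Q * A ^ n) atTop (𝓝 (Q - 0 * Q * 0)) :=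
    tendsto_const_nhds.sub (((tendsto_pow_atTop_nhds_zero_of_norm_lt_one hA').mul_const Q).mul
      (tendsto_pow_atTop_nhds_zero_of_norm_lt_one hA))
  rw [mul_zero, sub_zero] at hlim
  exact Matrix.nonneg_iff_posSemidef.mp
    (ge_of_tendsto' hlim fun n => Matrix.nonneg_iff_posSemidef.mpr (h n))

theorem isSymbol_of_fixed (hA : ‖A‖ < 1) (hΓ : (FreeMap.mk A B).IsCP)
    (hQ : (FreeMap.mk A B).act Q = Q) : IsSymbol Q := by
  refine ⟨Matrix.posSemidef_of_fixed hA hΓ.1 hQ, Matrix.posSemidef_of_fixed hA hΓ.2 ?_⟩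
  conv_rhs => rw [← hQ]
  simp only [FreeMap.act]
  noncomm_ring

theorem isUnit_one_sub_smul (hA : ‖A‖ < 1) {z : ℂ} (hz : ‖z‖ = 1) :
    IsUnit (1 - z • Aᴴ) := by
  refine isUnit_one_sub_of_norm_lt_one ?_
  rwa [norm_smul, hz, one_mul, Matrix.l2_opNorm_conjTranspose]

end Contraction

section ToeplitzSymbol
variable {d : ℕ} {A B X Q : Matrix (Fin d) (Fin d) ℂ}

/-- The factorization `σ(θ) = (K 1) [[B, X], [X*, B]] (K 1)*` with
`K = z A* (1 - z A*)⁻¹`, `z = e^{iθ}`. It rests on `B = Q - A* Q A` and on `K = z A* (1 + K)`. -/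
theorem toeplitzSymbol_eq_conj (hQh : Q.IsHermitian) (hB : B.IsHermitian) (hQ : Aᴴ * Q * A + B = Q)
    {θ : ℝ} (hu : IsUnit (1 - Complex.exp (Complex.I * θ) • Aᴴ)) :
    ∃ K : Matrix (Fin d) (Fin d) ℂ, toeplitzSymbol A B X Q θ =
      Matrix.fromCols K (1 : Matrix (Fin d) (Fin d) ℂ) * Matrix.fromBlocks B X Xᴴ B *
        (Matrix.fromCols K (1 : Matrix (Fin d) (Fin d) ℂ))ᴴ := by
  set z : ℂ := Complex.exp (Complex.I * θ) with hz
  have hzz : star z * z = 1 := by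
    rw [hz, Complex.star_def, Complex.conj_mul', mul_comm, Complex.norm_exp_ofReal_mul_I]
    simp
  set R := (1 - z • Aᴴ)⁻¹ with hR
  have hR1 : R * (1 - z • Aᴴ) = 1 :=
    Matrix.nonsing_inv_mul _ ((Matrix.isUnit_iff_isUnit_det _).mp hu)
  have hR2 : (1 - z • Aᴴ) * R = 1 :=
    Matrix.mul_nonsing_inv _ ((Matrix.isUnit_iff_isUnit_det _).mp hu)
  set K := (z • Aᴴ) * R with hK
  have hK1 : 1 + K = R := by
    rw [← hR2, hK]; noncomm_ring
  have hK2 : K = R * (z • Aᴴ) := by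
    rw [← sub_eq_zero]
    have : R * (z • Aᴴ) = R - 1 := by rw [← hR1]; noncomm_ring
    rw [this, ← hK1]; abel
  -- here the phase `z` cancels, since `K = R z A* = z A* R`
  have hP : K * Q * Kᴴ = (1 + K) * (Aᴴ * Q * A) * (1 + K)ᴴ := by
    rw [hK1, hK2]
    simp only [Matrix.conjTranspose_mul, Matrix.conjTranspose_smul,
      Matrix.conjTranspose_conjTranspose, Matrix.mul_smul, Matrix.smul_mul, smul_smul, hzz,
      one_smul, Matrix.mul_assoc]
  refine ⟨K, ?_⟩
  have hS : toeplitzSymbol A B X Q θ = Q + (K * (Q - B + X) + (K * (Q - B + X))ᴴ) := rfl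
  have hP' : Aᴴ * Q * A = Q - B := eq_sub_of_add_eq hQ
  rw [hP'] at hP
  rw [hS, Matrix.conjTranspose_fromCols_eq_fromRows_conjTranspose, Matrix.fromCols_mul_fromBlocks,
    Matrix.fromCols_mul_fromRows]
  simp only [Matrix.conjTranspose_mul, Matrix.conjTranspose_add, Matrix.conjTranspose_sub,
    hB.eq, hQh.eq, Matrix.conjTranspose_one, Matrix.one_mul, Matrix.mul_one] at hP ⊢
  have hP2 : K * B * Kᴴ = (Q - B) + K * (Q - B) + (Q - B) * Kᴴ := by
    have : K * B * Kᴴ = K * Q * Kᴴ - K * (Q - B) * Kᴴ := by noncomm_ring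
    rw [this, hP]
    noncomm_ring
  rw [Matrix.add_mul (K * B), hP2]
  noncomm_ring

theorem toeplitzSymbol_isSymbol (hQ1 : IsSymbol Q) (hΓ : (FreeMap.mk A B).IsCP)
    (hΛ : (compatibleExtension A B X).IsCP) (hQ : (FreeMap.mk A B).act Q = Q)
    {θ : ℝ} (hu : IsUnit (1 - Complex.exp (Complex.I * θ) • Aᴴ)) :
    IsSymbol (toeplitzSymbol A B X Q θ) := by
  constructor
  · obtain ⟨K, hK⟩ := toeplitzSymbol_eq_conj (X := X) hQ1.isHermitian hΓ.1.1 hQ hu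
    rw [hK]
    exact hΛ.1.mul_mul_conjTranspose_same _
  -- the complement `1 - σ` is the symbol of the same type with data
  -- `B ↦ 1 - A* A - B`, `X ↦ -A* A - X`, `Q ↦ 1 - Q`
  · have hQ' : Aᴴ * (1 - Q) * A + (1 - Aᴴ * A - B) = 1 - Q := by
      conv_rhs => rw [← hQ]
      simp only [FreeMap.act]
      noncomm_ring
    obtain ⟨K, hK⟩ := toeplitzSymbol_eq_conj (X := -(Aᴴ * A) - X) hQ1.2.1 hΓ.2.1 hQ' hu
    have e : 1 - toeplitzSymbol A B X Q θ =
        toeplitzSymbol A (1 - Aᴴ * A - B) (-(Aᴴ * A) - X) (1 - Q) θ := by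
      have e1 : 1 - Q - (1 - Aᴴ * A - B) + (-(Aᴴ * A) - X) = -(Q - B + X) := by abel
      simp only [toeplitzSymbol, e1, Matrix.mul_neg, Matrix.conjTranspose_neg]
      abel
    rw [e, hK]
    have e2 := hΛ.2
    rw [one_sub_compatibleExtension] at e2
    exact e2.mul_mul_conjTranspose_same _

theorem continuous_toeplitzSymbol
    (hu : ∀ θ : ℝ, IsUnit (1 - Complex.exp (Complex.I * θ) • Aᴴ)) :
    Continuous (toeplitzSymbol A B X Q) := by
  have h1 : Continuous fun θ : ℝ => Complex.exp (Complex.I * θ) := by fun_prop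
  have h2 : Continuous fun θ : ℝ => (1 - Complex.exp (Complex.I * θ) • Aᴴ)⁻¹ := by
    simp only [Matrix.inv_def, Ring.inverse_eq_inv']
    have h : Continuous fun θ : ℝ => 1 - Complex.exp (Complex.I * θ) • Aᴴ :=
      continuous_const.sub (h1.smul continuous_const)
    exact (h.matrix_det.inv₀ fun θ =>
      ((Matrix.isUnit_iff_isUnit_det _).mp (hu θ)).ne_zero).smul h.matrix_adjugate
  have h3 : Continuous fun θ : ℝ => (Complex.exp (Complex.I * θ) • Aᴴ) *
      (1 - Complex.exp (Complex.I * θ) • Aᴴ)⁻¹ * (Q - B + X) :=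
    ((h1.smul continuous_const).matrix_mul h2).matrix_mul continuous_const
  exact continuous_const.add (h3.add h3.matrix_conjTranspose)

end ToeplitzSymbol

/-! ### Block circulant matrices -/

section Fourier

/-- The `l`-th of the `N` equidistant angles on the circle. -/
noncomputable def fourierAngle (N l : ℕ) : ℝ := 2 * Real.pi * l / N

theorem exp_fourierAngle (N l : ℕ) :
    Complex.exp (Complex.I * fourierAngle N l) = Complex.exp (2 * Real.pi * Complex.I / N) ^ l := by
  rw [← Complex.exp_nat_mul, fourierAngle]
  congr 1
  push_cast
  ring

theorem exp_fourierAngle_pow_self {N : ℕ} (hN : N ≠ 0) (l : ℕ) :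
    Complex.exp (Complex.I * fourierAngle N l) ^ N = 1 := by
  rw [exp_fourierAngle, ← pow_mul, Nat.mul_comm, pow_mul,
    (Complex.isPrimitiveRoot_exp N hN).pow_eq_one, one_pow]

/-- Orthogonality of the characters of `ℤ/N`. -/
theorem sum_exp_fourierAngle {N : ℕ} (hN : N ≠ 0) (a b : ℕ) :
    ∑ l ∈ Finset.range N, Complex.exp (Complex.I * fourierAngle N l) ^ a *
      star (Complex.exp (Complex.I * fourierAngle N l)) ^ b =
        if a ≡ b [MOD N] then (N : ℂ) else 0 := by
  set ω : ℂ := Complex.exp (2 * Real.pi * Complex.I / N) with hω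
  have hprim : IsPrimitiveRoot ω N := Complex.isPrimitiveRoot_exp N hN
  have hone : star ω * ω = 1 := by
    rw [Complex.star_def, Complex.conj_mul', hprim.norm'_eq_one hN]; simp
  have hterm : ∀ l, Complex.exp (Complex.I * fourierAngle N l) ^ a *
      star (Complex.exp (Complex.I * fourierAngle N l)) ^ b = (ω ^ a * star ω ^ b) ^ l := by
    intro l
    rw [exp_fourierAngle, star_pow, mul_pow]
    ring
  simp only [hterm]
  have hiff : ω ^ a * star ω ^ b = 1 ↔ a ≡ b [MOD N] := by
    have h1 : star ω ^ b * ω ^ b = 1 := by rw [← mul_pow, hone, one_pow]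
    have hord : orderOf ω = N := hprim.eq_orderOf.symm
    have h2 : ω ^ a = ω ^ b ↔ a ≡ b [MOD N] := by
      rw [← hord]
      exact IsOfFinOrder.pow_eq_pow_iff_modEq
        (isOfFinOrder_iff_pow_eq_one.mpr ⟨N, Nat.pos_of_ne_zero hN, hprim.pow_eq_one⟩)
    rw [← h2]
    constructor
    · intro h
      calc ω ^ a = ω ^ a * (star ω ^ b * ω ^ b) := by rw [h1, mul_one]
        _ = (ω ^ a * star ω ^ b) * ω ^ b := by ring
        _ = ω ^ b := by rw [h, one_mul]
    · intro h
      rw [h, mul_comm, h1]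
  split_ifs with h
  · rw [hiff.mpr h]; simp
  · have hne : ω ^ a * star ω ^ b ≠ 1 := fun h' => h (hiff.mp h')
    have hpow : (ω ^ a * star ω ^ b) ^ N = 1 := by
      rw [mul_pow, ← pow_mul, ← pow_mul, Nat.mul_comm a, Nat.mul_comm b, pow_mul, pow_mul,
        ← star_pow ω N, hprim.pow_eq_one]
      simp
    rw [geom_sum_eq hne, hpow, sub_self, zero_div]

variable {d : ℕ}

/-- The unitary block discrete Fourier transform, from the `N` frequencies to the `N` sites. The
frequency comes second in its column index, as in `Matrix.blockDiagonal`. -/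
noncomputable def blockDFT (d N : ℕ) : Matrix (Fin N × Fin d) (Fin d × Fin N) ℂ :=
  Matrix.of fun p q =>
    if p.2 = q.1 then Complex.exp (Complex.I * fourierAngle N q.2) ^ (p.1 : ℕ) / Real.sqrt N else 0

/-- The block circulant matrix that the discrete Fourier transform turns into the block diagonal
matrix with blocks `σ 0, …, σ (N - 1)`. -/
noncomputable def blockCirculant (N : ℕ) (σ : ℕ → Matrix (Fin d) (Fin d) ℂ) :
    Matrix (Fin N × Fin d) (Fin N × Fin d) ℂ :=
  blockDFT d N * Matrix.blockDiagonal (fun l : Fin N => σ l) * (blockDFT d N)ᴴ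

theorem blockCirculant_apply (N : ℕ) (σ : ℕ → Matrix (Fin d) (Fin d) ℂ) (p q : Fin N × Fin d) :
    blockCirculant N σ p q =
      (1 / N : ℂ) * ∑ l ∈ Finset.range N, (Complex.exp (Complex.I * fourierAngle N l) ^ (p.1 : ℕ) *
        star (Complex.exp (Complex.I * fourierAngle N l)) ^ (q.1 : ℕ)) * σ l p.2 q.2 := by
  have hs : (Real.sqrt N : ℂ) * Real.sqrt N = N := by
    rw [← Complex.ofReal_mul, Real.mul_self_sqrt (by positivity)]; simp
  rw [← Fin.sum_univ_eq_sum_range (fun l =>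
    (Complex.exp (Complex.I * fourierAngle N l) ^ (p.1 : ℕ) *
      star (Complex.exp (Complex.I * fourierAngle N l)) ^ (q.1 : ℕ)) * σ l p.2 q.2), Finset.mul_sum]
  simp only [blockCirculant, Matrix.mul_apply, blockDFT, Matrix.of_apply,
    Matrix.blockDiagonal_apply, Fintype.sum_prod_type, Matrix.conjTranspose_apply, ite_mul,
    zero_mul, mul_ite, mul_zero,
    Finset.sum_ite_eq, Finset.mem_univ, if_true, Finset.sum_ite_irrel, apply_ite star, star_zero,
    Finset.sum_const_zero, Finset.sum_ite_eq']
  refine Finset.sum_congr rfl fun l _ => ?_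
  have hr : star (Real.sqrt N : ℂ) = Real.sqrt N := Complex.conj_ofReal _
  rw [star_div₀, star_pow, hr, ← hs]
  ring

theorem blockDFT_mul_conjTranspose {N : ℕ} (hN : N ≠ 0) :
    blockDFT d N * (blockDFT d N)ᴴ = 1 := by
  have := blockCirculant_apply N (fun _ => (1 : Matrix (Fin d) (Fin d) ℂ))
  have h1 : Matrix.blockDiagonal (fun _ : Fin N => (1 : Matrix (Fin d) (Fin d) ℂ)) = 1 :=
    Matrix.blockDiagonal_one
  simp only [blockCirculant, h1, Matrix.mul_one] at this
  ext ⟨j, a⟩ ⟨k, b⟩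
  have hmod : (j : ℕ) ≡ k [MOD N] ↔ j = k :=
    ⟨fun h => Fin.ext (h.eq_of_lt_of_lt j.2 k.2), fun h => h ▸ rfl⟩
  have hN' : (N : ℂ) ≠ 0 := Nat.cast_ne_zero.mpr hN
  rw [this, ← Finset.sum_mul, sum_exp_fourierAngle hN]
  simp only [hmod, Matrix.one_apply, Prod.mk.injEq]
  by_cases h1 : j = k <;> by_cases h2 : a = b <;> simp [h1, h2, hN']

theorem conjTranspose_mul_blockDFT {N : ℕ} (hN : N ≠ 0) :
    (blockDFT d N)ᴴ * blockDFT d N = 1 :=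
  (Matrix.mul_eq_one_comm_of_equiv (Equiv.prodComm _ _)).mp (blockDFT_mul_conjTranspose hN)

theorem Matrix.PosSemidef.blockDiagonal {m o : Type*} [Fintype m] [DecidableEq m] [Fintype o]
    [DecidableEq o] {M : o → Matrix m m ℂ} (hM : ∀ i, (M i).PosSemidef) :
    (Matrix.blockDiagonal M).PosSemidef := by
  have h : ∀ i, ∃ S : Matrix m m ℂ, M i = Sᴴ * S := fun i => by
    open scoped MatrixOrder in
    exact CStarAlgebra.nonneg_iff_eq_star_mul_self.mp (hM i).nonneg
  choose S hS using h
  have : Matrix.blockDiagonal M = (Matrix.blockDiagonal S)ᴴ * Matrix.blockDiagonal S := by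
    rw [Matrix.blockDiagonal_conjTranspose, ← Matrix.blockDiagonal_mul]
    exact congrArg _ (funext hS)
  rw [this]
  exact Matrix.posSemidef_conjTranspose_mul_self _

theorem blockCirculant_isSymbol {N : ℕ} (hN : N ≠ 0) {σ : ℕ → Matrix (Fin d) (Fin d) ℂ}
    (hσ : ∀ l, IsSymbol (σ l)) : IsSymbol (blockCirculant N σ) := by
  refine ⟨(Matrix.PosSemidef.blockDiagonal fun l : Fin N =>
    (hσ l).1).mul_mul_conjTranspose_same _, ?_⟩
  have h := (Matrix.PosSemidef.blockDiagonal fun l : Fin N =>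
    (hσ l).2).mul_mul_conjTranspose_same (blockDFT d N)
  have e : Matrix.blockDiagonal (fun l : Fin N => 1 - σ l) =
      1 - Matrix.blockDiagonal (fun l : Fin N => σ l) := by
    rw [← Matrix.blockDiagonal_one, ← Matrix.blockDiagonal_sub]
    rfl
  rwa [e, Matrix.mul_sub, Matrix.sub_mul, Matrix.mul_one, blockDFT_mul_conjTranspose hN] at h

theorem trace_blockCirculant_pow {N : ℕ} (hN : N ≠ 0) (σ : ℕ → Matrix (Fin d) (Fin d) ℂ) (m : ℕ) :
    (blockCirculant N σ ^ m).trace = ∑ l ∈ Finset.range N, (σ l ^ m).trace := by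
  have h : blockCirculant N σ ^ m = blockDFT d N *
      Matrix.blockDiagonal (fun l : Fin N => σ l ^ m) * (blockDFT d N)ᴴ := by
    induction m with
    | zero =>
      have : Matrix.blockDiagonal (fun l : Fin N => σ l ^ 0) = 1 := by
        simp only [pow_zero]; exact Matrix.blockDiagonal_one
      rw [this, Matrix.mul_one, blockDFT_mul_conjTranspose hN, pow_zero]
    | succ m ih =>
      have e : Matrix.blockDiagonal (fun l : Fin N => σ l ^ (m + 1)) =
          Matrix.blockDiagonal (fun l : Fin N => σ l ^ m) *
            Matrix.blockDiagonal (fun l : Fin N => σ l) := by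
        rw [← Matrix.blockDiagonal_mul]
        simp only [pow_succ]
      rw [pow_succ, ih, e, blockCirculant]
      simp only [Matrix.mul_assoc]
      rw [← Matrix.mul_assoc (blockDFT d N)ᴴ, conjTranspose_mul_blockDFT hN, Matrix.one_mul]
  rw [h, Matrix.trace_mul_cycle, conjTranspose_mul_blockDFT hN, Matrix.one_mul,
    Matrix.trace_blockDiagonal, Fin.sum_univ_eq_sum_range fun l => (σ l ^ m).trace]

/-- Traces of polynomials in a block circulant matrix are exact sums over the frequencies. -/
theorem trace_aeval_blockCirculant {N : ℕ} (hN : N ≠ 0) (σ : ℕ → Matrix (Fin d) (Fin d) ℂ)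
    (p : Polynomial ℝ) : (Polynomial.aeval (blockCirculant N σ) p).trace.re =
      ∑ l ∈ Finset.range N, (Polynomial.aeval (σ l) p).trace.re := by
  simp only [Matrix.trace_aeval_re, trace_blockCirculant_pow hN, Complex.re_sum, Finset.mul_sum]
  exact Finset.sum_comm

end Fourier

/-! ### Aliasing of the Fourier coefficients -/

section Aliasing
open scoped Matrix.Norms.L2Operator

variable {d : ℕ} {A B X Q Y : Matrix (Fin d) (Fin d) ℂ}

/-- The aliasing error in the `(j, k)` block when the Fourier coefficients of `z A* (1 - z A*)⁻¹ Y` are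
computed from its values at the `N`-th roots of unity `z`. -/
noncomputable def aliasBlock (A Y : Matrix (Fin d) (Fin d) ℂ) (N j k : ℕ) :
    Matrix (Fin d) (Fin d) ℂ :=
  Aᴴ ^ (N + k - j) * ((1 - Aᴴ ^ N)⁻¹ * Y)

theorem Matrix.l2_opNorm_one_le {ι : Type*} [Fintype ι] [DecidableEq ι] :
    ‖(1 : Matrix ι ι ℂ)‖ ≤ 1 :=
  IsSymbol.norm_le_one ⟨Matrix.PosSemidef.one, by simpa using Matrix.PosSemidef.zero⟩

theorem Matrix.l2_opNorm_pow_le {ι : Type*} [Fintype ι] [DecidableEq ι] (M : Matrix ι ι ℂ) (m : ℕ) :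
    ‖M ^ m‖ ≤ ‖M‖ ^ m := by
  cases m with
  | zero => simpa using Matrix.l2_opNorm_one_le
  | succ m => exact norm_pow_le' M (Nat.succ_pos m)

theorem norm_pow_lt_one (hA : ‖A‖ < 1) {N : ℕ} (hN : N ≠ 0) : ‖Aᴴ ^ N‖ < 1 := by
  refine (Matrix.l2_opNorm_pow_le _ _).trans_lt ?_
  rw [Matrix.l2_opNorm_conjTranspose]
  exact pow_lt_one₀ (norm_nonneg _) hA hN

theorem one_sub_pow_mul_inv (hA : ‖A‖ < 1) {N : ℕ} (hN : N ≠ 0) :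
    (1 - Aᴴ ^ N) * (1 - Aᴴ ^ N)⁻¹ = 1 :=
  Matrix.mul_nonsing_inv _ ((Matrix.isUnit_iff_isUnit_det _).mp
    (isUnit_one_sub_of_norm_lt_one (norm_pow_lt_one hA hN)))

theorem norm_inv_one_sub_pow_le (hA : ‖A‖ < 1) {N : ℕ} (hN : N ≠ 0) :
    ‖(1 - Aᴴ ^ N)⁻¹‖ ≤ (1 - ‖A‖)⁻¹ := by
  set P := (1 - Aᴴ ^ N)⁻¹ with hP
  have h1 : P = 1 + Aᴴ ^ N * P := by
    have := one_sub_pow_mul_inv hA hN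
    rw [← hP, Matrix.sub_mul, Matrix.one_mul, sub_eq_iff_eq_add] at this
    exact this
  have h2 : ‖Aᴴ ^ N‖ ≤ ‖A‖ := by
    refine (Matrix.l2_opNorm_pow_le _ _).trans ?_
    rw [Matrix.l2_opNorm_conjTranspose]
    exact pow_le_of_le_one (norm_nonneg _) hA.le hN
  have h3 : ‖P‖ ≤ 1 + ‖A‖ * ‖P‖ := by
    conv_lhs => rw [h1]
    refine (norm_add_le _ _).trans (add_le_add Matrix.l2_opNorm_one_le ?_)
    exact (norm_mul_le _ _).trans (mul_le_mul_of_nonneg_right h2 (norm_nonneg _))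
  rw [← one_div, le_div_iff₀ (by linarith)]
  linarith

theorem norm_aliasBlock_le (hA : ‖A‖ < 1) {N : ℕ} (hN : N ≠ 0) (j k : ℕ) :
    ‖aliasBlock A Y N j k‖ ≤ ‖A‖ ^ (N + k - j) * ((1 - ‖A‖)⁻¹ * ‖Y‖) := by
  refine (norm_mul_le _ _).trans (mul_le_mul ?_ ?_ (norm_nonneg _) (by positivity))
  · exact (Matrix.l2_opNorm_pow_le _ _).trans_eq (by rw [Matrix.l2_opNorm_conjTranspose])
  · exact (norm_mul_le _ _).trans
      (mul_le_mul_of_nonneg_right (norm_inv_one_sub_pow_le hA hN) (norm_nonneg _))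

/-- For `z ^ N = 1` the resolvent is a finite geometric sum. -/
theorem inv_one_sub_smul_eq (hA : ‖A‖ < 1) {N : ℕ} (hN : N ≠ 0) {z : ℂ} (hz : z ^ N = 1) :
    (1 - z • Aᴴ)⁻¹ = (∑ r ∈ Finset.range N, z ^ r • Aᴴ ^ r) * (1 - Aᴴ ^ N)⁻¹ := by
  refine Matrix.inv_eq_right_inv ?_
  have h := mul_neg_geom_sum (z • Aᴴ) N
  simp only [smul_pow, hz, one_smul] at h
  rw [← Matrix.mul_assoc, h, one_sub_pow_mul_inv hA hN]

/-- The discrete Fourier coefficients of `z A* (1 - z A*)⁻¹ Y`: orthogonality of characters keeps a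
single power of `A*`. -/
theorem fourierSum_resolvent (hA : ‖A‖ < 1) {N : ℕ} (hN : N ≠ 0) {j k : ℕ} (hj : j < N)
    (hk : k < N) :
    (1 / N : ℂ) • ∑ l ∈ Finset.range N, (Complex.exp (Complex.I * fourierAngle N l) ^ j *
        star (Complex.exp (Complex.I * fourierAngle N l)) ^ k) •
      ((Complex.exp (Complex.I * fourierAngle N l) • Aᴴ) *
        (1 - Complex.exp (Complex.I * fourierAngle N l) • Aᴴ)⁻¹ * Y) =
      (if j < k then Aᴴ ^ (k - j) * Y else 0) + aliasBlock A Y N j k := by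
  set P := (1 - Aᴴ ^ N)⁻¹ with hP
  have hN' : (N : ℂ) ≠ 0 := Nat.cast_ne_zero.mpr hN
  have h1 : ∀ l, (Complex.exp (Complex.I * fourierAngle N l) ^ j *
        star (Complex.exp (Complex.I * fourierAngle N l)) ^ k) •
      ((Complex.exp (Complex.I * fourierAngle N l) • Aᴴ) *
        (1 - Complex.exp (Complex.I * fourierAngle N l) • Aᴴ)⁻¹ * Y) =
      ∑ r ∈ Finset.range N, (Complex.exp (Complex.I * fourierAngle N l) ^ (j + r + 1) *
        star (Complex.exp (Complex.I * fourierAngle N l)) ^ k) • (Aᴴ ^ (r + 1) * (P * Y)) := by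
    intro l
    rw [inv_one_sub_smul_eq hA hN (exp_fourierAngle_pow_self hN l), Matrix.mul_assoc,
      Matrix.mul_assoc, Matrix.sum_mul, Matrix.mul_sum, Finset.smul_sum]
    refine Finset.sum_congr rfl fun r _ => ?_
    simp only [Matrix.smul_mul, Matrix.mul_smul, smul_smul, pow_succ', Matrix.mul_assoc]
    congr 1
    ring
  simp only [h1]
  rw [Finset.sum_comm]
  simp only [← Finset.sum_smul, sum_exp_fourierAngle hN]
  -- the only `r < N` with `j + r + 1 ≡ k` modulo `N`
  set r₀ := if j < k then k - j - 1 else N + k - j - 1 with hr₀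
  have hr₀N : r₀ < N := by simp only [hr₀]; split_ifs <;> omega
  have hiff : ∀ r ∈ Finset.range N, (j + r + 1 ≡ k [MOD N]) ↔ r = r₀ := by
    have hr0 : j + r₀ + 1 ≡ k [MOD N] := by
      simp only [hr₀]
      split_ifs with h
      · rw [show j + (k - j - 1) + 1 = k by omega]
      · rw [show j + (N + k - j - 1) + 1 = N + k by omega]
        exact Nat.add_modEq_left
    intro r hr
    constructor
    · intro h
      have h2 : j + 1 + r ≡ j + 1 + r₀ [MOD N] := by
        rw [show j + 1 + r = j + r + 1 by ring, show j + 1 + r₀ = j + r₀ + 1 by ring]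
        exact h.trans hr0.symm
      exact (Nat.ModEq.add_left_cancel' _ h2).eq_of_lt_of_lt (Finset.mem_range.mp hr) hr₀N
    · rintro rfl; exact hr0
  rw [Finset.sum_congr rfl fun r hr => by rw [if_congr (hiff r hr) rfl rfl]]
  simp only [ite_smul, zero_smul, Finset.sum_ite_eq', Finset.mem_range, hr₀N, if_true, smul_smul]
  rw [one_div_mul_cancel hN', one_smul, aliasBlock, ← hP]
  have hPP : P = 1 + Aᴴ ^ N * P := by
    have := one_sub_pow_mul_inv hA hN
    rw [← hP, Matrix.sub_mul, Matrix.one_mul, sub_eq_iff_eq_add] at this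
    exact this
  split_ifs with h
  · have e1 : r₀ + 1 = k - j := by simp only [hr₀, if_pos h]; omega
    have e2 : N + k - j = (k - j) + N := by omega
    rw [e1, e2, pow_add]
    nth_rewrite 1 [hPP]
    noncomm_ring
  · have e1 : r₀ + 1 = N + k - j := by simp only [hr₀, if_neg h]; omega
    rw [e1, zero_add]

end Aliasing

/-! ### The entropy of block Toeplitz symbols -/

section Szego
open scoped Matrix.Norms.L2Operator

variable {d : ℕ} {A B X Q : Matrix (Fin d) (Fin d) ℂ}

/-- The discrete Fourier coefficients of the Toeplitz symbol are the blocks of the Toeplitz matrix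
up to aliasing. -/
theorem fourierSum_toeplitzSymbol (hA : ‖A‖ < 1) {N : ℕ} (hN : N ≠ 0) {j k : ℕ} (hj : j < N)
    (hk : k < N) :
    (1 / N : ℂ) • ∑ l ∈ Finset.range N, (Complex.exp (Complex.I * fourierAngle N l) ^ j *
        star (Complex.exp (Complex.I * fourierAngle N l)) ^ k) •
      toeplitzSymbol A B X Q (fourierAngle N l) =
    toeplitzBlock A Q (Q - B + X) j k +
      (aliasBlock A (Q - B + X) N j k + (aliasBlock A (Q - B + X) N k j)ᴴ) := by
  have hN' : (N : ℂ) ≠ 0 := Nat.cast_ne_zero.mpr hN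
  have h1 := fourierSum_resolvent (Y := Q - B + X) hA hN hj hk
  have h2 := congrArg Matrix.conjTranspose (fourierSum_resolvent (Y := Q - B + X) hA hN hk hj)
  have h3 : (1 / N : ℂ) • ∑ l ∈ Finset.range N, (Complex.exp (Complex.I * fourierAngle N l) ^ j *
        star (Complex.exp (Complex.I * fourierAngle N l)) ^ k) • Q = if j = k then Q else 0 := by
    have hmod : j ≡ k [MOD N] ↔ j = k :=
      ⟨fun h => h.eq_of_lt_of_lt hj hk, fun h => h ▸ rfl⟩
    rw [← Finset.sum_smul, sum_exp_fourierAngle hN, if_congr hmod rfl rfl, smul_smul]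
    split_ifs <;> simp [hN']
  rw [Matrix.conjTranspose_smul, Matrix.conjTranspose_sum, Matrix.conjTranspose_add] at h2
  simp only [Matrix.conjTranspose_smul, star_mul', star_pow, star_star] at h2
  have hN2 : star (1 / N : ℂ) = 1 / N := by simp
  have hsum := congrArg₂ (· + ·) h3 (congrArg₂ (· + ·) h1 h2)
  simp only [hN2, ← smul_add, ← Finset.sum_add_distrib] at hsum
  have hL : ∀ l, toeplitzSymbol A B X Q (fourierAngle N l) = Q +
      ((Complex.exp (Complex.I * fourierAngle N l) • Aᴴ) *
        (1 - Complex.exp (Complex.I * fourierAngle N l) • Aᴴ)⁻¹ * (Q - B + X) +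
      ((Complex.exp (Complex.I * fourierAngle N l) • Aᴴ) *
        (1 - Complex.exp (Complex.I * fourierAngle N l) • Aᴴ)⁻¹ * (Q - B + X))ᴴ) := fun l => rfl
  simp only [hL]
  convert hsum using 1
  · congr 1
    refine Finset.sum_congr rfl fun l _ => ?_
    rw [smul_add, smul_add, mul_comm (star _ ^ k)]
  · rw [toeplitzBlock]
    rcases lt_trichotomy j k with h | rfl | h
    · simp only [h, h.ne, h.not_gt, if_true, if_false, Matrix.conjTranspose_zero]
      abel
    · simp only [lt_irrefl, if_true, if_false, Matrix.conjTranspose_zero]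
      abel
    · simp only [h, h.ne', h.not_gt, if_true, if_false, Matrix.conjTranspose_mul,
        Matrix.conjTranspose_pow, Matrix.conjTranspose_conjTranspose]
      abel

theorem exp_I_mul_add_two_pi (θ : ℝ) :
    Complex.exp (Complex.I * ((θ + 2 * Real.pi : ℝ) : ℂ)) = Complex.exp (Complex.I * θ) := by
  rw [mul_comm Complex.I, mul_comm Complex.I]
  push_cast
  exact Complex.exp_mul_I_periodic θ

theorem periodic_toeplitzSymbol (A B X Q : Matrix (Fin d) (Fin d) ℂ) :
    Function.Periodic (toeplitzSymbol A B X Q) (2 * Real.pi) := by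
  intro θ
  simp only [toeplitzSymbol, exp_I_mul_add_two_pi]

theorem tendsto_aliasBlock {Y : Matrix (Fin d) (Fin d) ℂ} (hA : ‖A‖ < 1) (j k : ℕ) (a b : Fin d) :
    Tendsto (fun N => aliasBlock A Y N j k a b) atTop (𝓝 0) := by
  have h1 : Tendsto (fun N : ℕ => N + k - j) atTop atTop :=
    tendsto_atTop_atTop.mpr fun m => ⟨m + j, fun N hN => by omega⟩
  have h2 := (tendsto_pow_atTop_nhds_zero_of_lt_one (norm_nonneg A) hA).comp h1
  have h3 := h2.mul_const ((1 - ‖A‖)⁻¹ * ‖Y‖)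
  rw [zero_mul] at h3
  refine squeeze_zero_norm' ?_ h3
  filter_upwards [eventually_ne_atTop 0] with N hN
  exact (Matrix.norm_entry_le_l2_opNorm _ a b).trans (norm_aliasBlock_le hA hN j k)

theorem Function.Periodic.tendsto_fourierSum {f : ℝ → ℂ} (hp : Function.Periodic f (2 * Real.pi))
    (hf : Continuous f) :
    Tendsto (fun N : ℕ => (1 / (N : ℂ)) * ∑ l ∈ Finset.range N, f (fourierAngle N l)) atTop
      (𝓝 ((1 / (2 * Real.pi) : ℂ) * ∫ θ in (-Real.pi)..Real.pi, f θ)) := by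
  have h := hp.intervalIntegral_add_eq 0 (-Real.pi)
  rw [zero_add, show -Real.pi + 2 * Real.pi = Real.pi by ring] at h
  rw [← h]
  exact tendsto_riemannSum hf

/-- The blocks are the Fourier coefficients of the symbol, as limits of the discrete ones. -/
theorem toeplitzBlock_eq_integral (hA : ‖A‖ < 1) (hσ : Continuous (toeplitzSymbol A B X Q))
    (j k : ℕ) (a b : Fin d) :
    toeplitzBlock A Q (Q - B + X) j k a b =
      (1 / (2 * Real.pi) : ℂ) * ∫ θ in (-Real.pi)..Real.pi,
        toeplitzSymbol A B X Q θ a b *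
          Complex.exp (-(Complex.I * ((k : ℂ) - (j : ℂ)) * θ)) := by
  have hexp : ∀ θ : ℝ, Complex.exp (-(Complex.I * ((k : ℂ) - (j : ℂ)) * θ)) =
      Complex.exp (Complex.I * θ) ^ j * star (Complex.exp (Complex.I * θ)) ^ k := by
    intro θ
    rw [Complex.star_def, ← Complex.exp_conj, ← Complex.exp_nat_mul, ← Complex.exp_nat_mul,
      ← Complex.exp_add]
    congr 1
    simp
    ring
  simp only [hexp]
  have hc : Continuous fun θ : ℝ => toeplitzSymbol A B X Q θ a b *
      (Complex.exp (Complex.I * θ) ^ j * star (Complex.exp (Complex.I * θ)) ^ k) := by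
    have : Continuous fun θ : ℝ => Complex.exp (Complex.I * θ) := by fun_prop
    exact (hσ.matrix_elem a b).mul ((this.pow j).mul (this.star.pow k))
  have hper : Function.Periodic (fun θ : ℝ => toeplitzSymbol A B X Q θ a b *
      (Complex.exp (Complex.I * θ) ^ j * star (Complex.exp (Complex.I * θ)) ^ k))
      (2 * Real.pi) := by
    intro θ
    simp only [periodic_toeplitzSymbol A B X Q θ, exp_I_mul_add_two_pi]
  refine tendsto_nhds_unique ?_ (hper.tendsto_fourierSum hc)
  have hlim : Tendsto (fun N : ℕ => toeplitzBlock A Q (Q - B + X) j k a b +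
      (aliasBlock A (Q - B + X) N j k a b + star (aliasBlock A (Q - B + X) N k j b a))) atTop
      (𝓝 (toeplitzBlock A Q (Q - B + X) j k a b + (0 + star 0))) :=
    tendsto_const_nhds.add ((tendsto_aliasBlock hA j k a b).add
      (tendsto_aliasBlock hA k j b a).star)
  rw [star_zero, add_zero, add_zero] at hlim
  refine hlim.congr' ?_
  filter_upwards [eventually_gt_atTop j, eventually_gt_atTop k] with N hj hk
  have h := fourierSum_toeplitzSymbol (B := B) (X := X) (Q := Q) hA (by omega : N ≠ 0) hj hk
  have h' := congrFun (congrFun h a) b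
  simp only [Matrix.smul_apply, Matrix.sum_apply, Matrix.add_apply, smul_eq_mul,
    Matrix.conjTranspose_apply] at h'
  rw [← h']
  simp only [mul_comm (toeplitzSymbol A B X Q _ a b)]

/-- The entrywise `ℓ¹` distance of the Toeplitz and the circulant matrix is bounded uniformly in the
size. -/
theorem sum_norm_blockToeplitz_sub_blockCirculant_le (hA : ‖A‖ < 1) :
    ∃ K : ℝ, 0 ≤ K ∧ ∀ N : ℕ, N ≠ 0 → ∑ p, ∑ q, ‖(blockToeplitz A Q (Q - B + X) N -
      blockCirculant N (fun l => toeplitzSymbol A B X Q (fourierAngle N l))) p q‖ ≤ K := by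
  set Y := Q - B + X with hY
  set r := ‖A‖ with hr
  have hr0 : 0 ≤ r := norm_nonneg A
  have hr1 : 0 < 1 - r := by linarith
  set c := (1 - r)⁻¹ * ‖Y‖ with hc
  have hc0 : 0 ≤ c := by positivity
  refine ⟨d * (d * (2 * ((1 - r)⁻¹ * (1 - r)⁻¹))) * c, by positivity, fun N hN => ?_⟩
  -- the error in block `(j, k)` decays away from the corners `(N - 1, 0)` and `(0, N - 1)`
  have hpow : ∀ j k : Fin N, r ^ (N + (k : ℕ) - j) ≤ r ^ (j.rev : ℕ) * r ^ (k : ℕ) := by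
    intro j k
    rw [← pow_add]
    refine pow_le_pow_of_le_one hr0 hA.le ?_
    rw [Fin.val_rev]
    omega
  have hentry : ∀ p q : Fin N × Fin d, ‖(blockToeplitz A Q Y N -
      blockCirculant N (fun l => toeplitzSymbol A B X Q (fourierAngle N l))) p q‖ ≤
      (r ^ (p.1.rev : ℕ) * r ^ (q.1 : ℕ) + r ^ (q.1.rev : ℕ) * r ^ (p.1 : ℕ)) * c := by
    intro p q
    have h := congrFun (congrFun (fourierSum_toeplitzSymbol (B := B) (X := X) (Q := Q) hA hN
      p.1.2 q.1.2) p.2) q.2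
    simp only [Matrix.smul_apply, Matrix.sum_apply, Matrix.add_apply, smul_eq_mul,
      Matrix.conjTranspose_apply] at h
    rw [Matrix.sub_apply,
      blockCirculant_apply N (fun l => toeplitzSymbol A B X Q (fourierAngle N l)),
      h, blockToeplitz, Matrix.of_apply, sub_add_cancel_left, norm_neg, add_mul]
    refine (norm_add_le _ _).trans (add_le_add ?_ ?_)
    · exact (Matrix.norm_entry_le_l2_opNorm _ _ _).trans ((norm_aliasBlock_le hA hN _ _).trans
        (mul_le_mul_of_nonneg_right (hpow _ _) hc0))
    · rw [norm_star]
      exact (Matrix.norm_entry_le_l2_opNorm _ _ _).trans ((norm_aliasBlock_le hA hN _ _).trans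
        (mul_le_mul_of_nonneg_right (hpow _ _) hc0))
  have hgeom : ∑ k : Fin N, r ^ (k : ℕ) ≤ (1 - r)⁻¹ := by
    rw [Fin.sum_univ_eq_sum_range (fun k => r ^ k), ← tsum_geometric_of_lt_one hr0 hA]
    exact (summable_geometric_of_lt_one hr0 hA).sum_le_tsum _ fun _ _ => by positivity
  have hgeom' : ∑ k : Fin N, r ^ (k.rev : ℕ) = ∑ k : Fin N, r ^ (k : ℕ) :=
    Fintype.sum_equiv Fin.revPerm _ _ fun _ => rfl
  have hg0 : 0 ≤ ∑ k : Fin N, r ^ (k : ℕ) := by positivity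
  calc _ ≤ ∑ p : Fin N × Fin d, ∑ q : Fin N × Fin d,
        (r ^ (p.1.rev : ℕ) * r ^ (q.1 : ℕ) + r ^ (q.1.rev : ℕ) * r ^ (p.1 : ℕ)) * c :=
        Finset.sum_le_sum fun p _ => Finset.sum_le_sum fun q _ => hentry p q
    _ = d * (d * (2 * ((∑ k : Fin N, r ^ (k : ℕ)) * ∑ k : Fin N, r ^ (k : ℕ)))) * c := by
        simp only [Fintype.sum_prod_type, Finset.sum_const, Finset.card_univ, Fintype.card_fin,
          nsmul_eq_mul, ← Finset.mul_sum, ← Finset.sum_mul, Finset.sum_add_distrib, hgeom']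
        ring
    _ ≤ _ := by gcongr

/-- Szegő's limit theorem for the entropy of the block Toeplitz matrices. -/
theorem tendsto_entropy_blockToeplitz (hA : ‖A‖ < 1) (hσ : Continuous (toeplitzSymbol A B X Q))
    (hs : ∀ θ, IsSymbol (toeplitzSymbol A B X Q θ))
    (hT : ∀ n, IsSymbol (blockToeplitz A Q (Q - B + X) n)) :
    Tendsto (fun n : ℕ => symbolEntropy (blockToeplitz A Q (Q - B + X) (n + 1)) / ((n : ℝ) + 1))
      atTop (𝓝 (1 / (2 * Real.pi) * ∫ θ in (-Real.pi)..Real.pi,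
        symbolEntropy (toeplitzSymbol A B X Q θ))) := by
  set L := 1 / (2 * Real.pi) * ∫ θ in (-Real.pi)..Real.pi,
    symbolEntropy (toeplitzSymbol A B X Q θ) with hL
  set T : (N : ℕ) → Matrix (Fin N × Fin d) (Fin N × Fin d) ℂ :=
    blockToeplitz A Q (Q - B + X) with hTdef
  set S : ℕ → ℝ := fun N => 1 / (N : ℝ) * ∑ l ∈ Finset.range N,
    symbolEntropy (toeplitzSymbol A B X Q (fourierAngle N l)) with hS
  have hSL : Tendsto S atTop (𝓝 L) := by
    have hper : Function.Periodic (fun θ : ℝ => (symbolEntropy (toeplitzSymbol A B X Q θ) : ℂ))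
        (2 * Real.pi) := fun θ => by simp only [periodic_toeplitzSymbol A B X Q θ]
    have h := hper.tendsto_fourierSum
      (Complex.continuous_ofReal.comp (continuous_symbolEntropy hσ hs))
    have h' := (Complex.continuous_re.tendsto _).comp h
    rw [intervalIntegral.integral_ofReal] at h'
    convert h' using 2
    · funext N
      simp only [hS, Function.comp]
      rw [← Complex.ofReal_re (1 / _ * ∑ _ ∈ _, _)]
      push_cast
      rfl
    · rw [hL, ← Complex.ofReal_re (1 / _ * _)]
      push_cast
      rfl
  have hdiff : Tendsto (fun N : ℕ => symbolEntropy (T N) / N - S N) atTop (𝓝 0) := by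
    obtain ⟨K, hK0, hK⟩ := sum_norm_blockToeplitz_sub_blockCirculant_le
      (B := B) (X := X) (Q := Q) hA
    rw [Metric.tendsto_atTop]
    intro ε hε
    set δ := ε / (4 * (d + 1)) with hδ
    have hδ0 : 0 < δ := by positivity
    have hdδ : d * δ ≤ ε / 4 := by
      rw [hδ, mul_div_assoc', div_le_div_iff₀ (by positivity) (by norm_num)]
      nlinarith
    obtain ⟨p, hp⟩ := exists_polynomial_near_of_continuousOn 0 1 Real.binEntropy
      Real.binEntropy_continuous.continuousOn δ hδ0
    have hp' : ∀ x ∈ Set.Icc (0 : ℝ) 1, |p.eval x - Real.binEntropy x| ≤ δ :=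
      fun x hx => (hp x hx).le
    set M := ∑ m ∈ Finset.range (p.natDegree + 1), |p.coeff m| * m with hM
    have hM0 : 0 ≤ M := Finset.sum_nonneg fun m _ => by positivity
    obtain ⟨N₀, hN₀⟩ := exists_nat_gt (M * K / (ε / 4))
    refine ⟨N₀ + 1, fun N hN => ?_⟩
    have hN0 : N ≠ 0 := by omega
    have hNpos : (0 : ℝ) < N := by positivity
    have hMK : M * K ≤ N * (ε / 4) := by
      rw [div_lt_iff₀ (by positivity)] at hN₀
      have : (N₀ : ℝ) ≤ N := by exact_mod_cast (by omega : N₀ ≤ N)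
      nlinarith
    set σ : ℕ → Matrix (Fin d) (Fin d) ℂ := fun l => toeplitzSymbol A B X Q (fourierAngle N l)
      with hσdef
    have hC : IsSymbol (blockCirculant N σ) := blockCirculant_isSymbol hN0 fun l => hs _
    -- compare with the circulant matrix through the polynomial `p`
    have h1 : |symbolEntropy (T N) - (Polynomial.aeval (T N) p).trace.re| ≤ N * (ε / 4) := by
      refine ((hT N).abs_entropy_sub_le hp').trans ?_
      rw [Fintype.card_prod, Fintype.card_fin, Fintype.card_fin, Nat.cast_mul, mul_assoc]
      gcongr
    have h2 : |(Polynomial.aeval (T N) p).trace.re -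
        (Polynomial.aeval (blockCirculant N σ) p).trace.re| ≤ N * (ε / 4) :=
      ((Matrix.abs_trace_aeval_sub_le p (hT N).norm_le_one hC.norm_le_one).trans
        (mul_le_mul_of_nonneg_left (hK N hN0) hM0)).trans hMK
    have h3 : |(Polynomial.aeval (blockCirculant N σ) p).trace.re -
        ∑ l ∈ Finset.range N, symbolEntropy (σ l)| ≤ N * (ε / 4) := by
      rw [trace_aeval_blockCirculant hN0, ← Finset.sum_sub_distrib]
      refine (Finset.abs_sum_le_sum_abs _ _).trans ?_
      refine (Finset.sum_le_sum (g := fun _ => ε / 4) fun l _ => ?_).trans_eq (by simp)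
      rw [abs_sub_comm]
      exact ((hs _).abs_entropy_sub_le hp').trans (by rw [Fintype.card_fin]; exact hdδ)
    have h4 : |symbolEntropy (T N) - ∑ l ∈ Finset.range N, symbolEntropy (σ l)| < N * ε := by
      have := abs_le.mp h1; have := abs_le.mp h2; have := abs_le.mp h3
      have : 0 < N * ε := by positivity
      rw [abs_lt]
      constructor <;> linarith
    have h5 : symbolEntropy (T N) / N - S N =
        (symbolEntropy (T N) - ∑ l ∈ Finset.range N, symbolEntropy (σ l)) / N := by
      simp only [hS, hσdef]; ring
    rw [dist_zero_right, Real.norm_eq_abs, h5, abs_div, abs_of_pos hNpos, div_lt_iff₀ hNpos,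
      mul_comm ε]
    exact h4
  have h := (hdiff.add hSL).comp (tendsto_add_atTop_nat 1)
  rw [zero_add] at h
  refine h.congr fun n => ?_
  simp only [Function.comp, sub_add_cancel]
  push_cast
  rfl

end Szego

/-- Consecutive sites of a block Toeplitz matrix carry the smaller block Toeplitz matrix. -/
theorem blockToeplitz_submatrix {d n m s : ℕ} {A Q Y : Matrix (Fin d) (Fin d) ℂ} {f : Fin n → Fin m}
    (hf : ∀ j, (f j : ℕ) = j + s) :
    (blockToeplitz A Q Y m).submatrix (Prod.map f id) (Prod.map f id) = blockToeplitz A Q Y n := by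
  ext ⟨j, a⟩ ⟨k, b⟩
  simp only [Matrix.submatrix_apply, Prod.map, id, blockToeplitz, toeplitzBlock,
    Matrix.of_apply, hf, Nat.add_sub_add_right, add_lt_add_iff_right]

/-- The entropies of the principal submatrices of a block Toeplitz symbol form a concave sequence:
strong subadditivity for the first site, the last site and the sites between them. -/
theorem symbolEntropy_blockToeplitz_concave {d : ℕ} {A Q Y : Matrix (Fin d) (Fin d) ℂ} {n : ℕ}
    (hT : IsSymbol (blockToeplitz A Q Y (n + 2))) :
    symbolEntropy (blockToeplitz A Q Y (n + 2)) + symbolEntropy (blockToeplitz A Q Y n) ≤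
    symbolEntropy (blockToeplitz A Q Y (n + 1)) + symbolEntropy (blockToeplitz A Q Y (n + 1)) := by
  let f : (Fin n × Fin d) ⊕ (Fin d ⊕ Fin d) → Fin (n + 2) × Fin d :=
    Sum.elim (fun p => (p.1.succ.castSucc, p.2))
      (Sum.elim (fun a => (0, a)) (fun a => (Fin.last (n + 1), a)))
  let g : (Fin n × Fin d) ⊕ Fin d → Fin (n + 1) × Fin d :=
    Sum.elim (fun p => (p.1.succ, p.2)) (fun a => (0, a))
  let h : (Fin n × Fin d) ⊕ Fin d → Fin (n + 1) × Fin d :=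
    Sum.elim (fun p => (p.1.castSucc, p.2)) (fun a => (Fin.last n, a))
  have hf : f.Bijective := by
    rw [Fintype.bijective_iff_injective_and_card]
    refine ⟨?_, by simp; ring⟩
    rintro (⟨j, a⟩ | a | a) (⟨k, b⟩ | b | b) hab <;>
      simp [f, Fin.ext_iff] at hab ⊢ <;> omega
  have hg : g.Bijective := by
    rw [Fintype.bijective_iff_injective_and_card]
    refine ⟨?_, by simp; ring⟩
    rintro (⟨j, a⟩ | a) (⟨k, b⟩ | b) hab <;>
      simp [g, Fin.ext_iff] at hab ⊢ <;> omega
  have hh : h.Bijective := by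
    rw [Fintype.bijective_iff_injective_and_card]
    refine ⟨?_, by simp; ring⟩
    rintro (⟨j, a⟩ | a) (⟨k, b⟩ | b) hab <;>
      simp [h, Fin.ext_iff] at hab ⊢ <;> omega
  have hsucc : (blockToeplitz A Q Y (n + 2)).submatrix (Prod.map Fin.succ id)
      (Prod.map Fin.succ id) = blockToeplitz A Q Y (n + 1) :=
    blockToeplitz_submatrix (s := 1) fun j => Fin.val_succ j
  have hcast : (blockToeplitz A Q Y (n + 2)).submatrix (Prod.map Fin.castSucc id)
      (Prod.map Fin.castSucc id) = blockToeplitz A Q Y (n + 1) :=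
    blockToeplitz_submatrix (s := 0) fun j => rfl
  have hmid : (blockToeplitz A Q Y (n + 2)).submatrix (f ∘ Sum.inl) (f ∘ Sum.inl) =
      blockToeplitz A Q Y n :=
    blockToeplitz_submatrix (s := 1) (f := fun j : Fin n => j.succ.castSucc) fun j => rfl
  have hH := hT.isHermitian
  have hH1 : (blockToeplitz A Q Y (n + 1)).IsHermitian := hsucc ▸ hH.submatrix _
  have hM : IsSymbol ((blockToeplitz A Q Y (n + 2)).submatrix f f) := by
    refine ⟨hT.1.submatrix f, ?_⟩
    have := hT.2.submatrix f
    rwa [Matrix.submatrix_sub, Pi.sub_apply, Pi.sub_apply, Matrix.submatrix_one _ hf.1] at this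
  have key := hM.entropy_submodular
  -- `f` orders the sites as (middle, first, last); dropping the last (first) of them leaves the
  -- initial (final) `n + 1` sites
  have hfg : f ∘ Sum.map id Sum.inl = Prod.map Fin.castSucc id ∘ g := by
    ext (p | a) <;> rfl
  have hfh : f ∘ Sum.map id Sum.inr = Prod.map Fin.succ id ∘ h := by
    ext (p | a) <;> rfl
  rw [Matrix.submatrix_submatrix, Matrix.submatrix_submatrix, Matrix.submatrix_submatrix, hmid, hfg,
    hfh, ← Matrix.submatrix_submatrix, ← Matrix.submatrix_submatrix, hcast, hsucc] at key
  have e1 := symbolEntropy_submatrix hH (Equiv.ofBijective f hf)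
  have e2 := symbolEntropy_submatrix hH1 (Equiv.ofBijective g hg)
  have e3 := symbolEntropy_submatrix hH1 (Equiv.ofBijective h hh)
  rw [Equiv.coe_ofBijective] at e1 e2 e3
  rwa [e1, e2, e3] at key

theorem mainTheorem2 (d : ℕ) (A B X Q : Matrix (Fin d) (Fin d) ℂ)
    (hΓ : (FreeMap.mk A B).IsCP)
    (hΛ : (compatibleExtension A B X).IsCP)
    (hQ : (FreeMap.mk A B).act Q = Q) :
    -- the process and its symbol are well defined
    (∀ n : ℕ, IsSymbol (processMarginal (compatibleExtension A B X) Q n)) ∧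
    (∀ θ : ℝ, IsUnit (1 - Complex.exp (Complex.I * θ) • Aᴴ)) ∧
    (∀ θ : ℝ, IsSymbol (toeplitzSymbol A B X Q θ)) ∧
    -- the process is block Toeplitz with the given symbol
    (∀ (n : ℕ) (j k : Fin n) (a b : Fin d),
      processMarginal (compatibleExtension A B X) Q n (j, a) (k, b) =
        (1 / (2 * Real.pi) : ℂ) * ∫ θ in (-Real.pi)..Real.pi,
          toeplitzSymbol A B X Q θ a b *
            Complex.exp (-(Complex.I * ((k : ℂ) - (j : ℂ)) * θ))) ∧
    IntervalIntegrable (fun θ : ℝ => symbolEntropy (toeplitzSymbol A B X Q θ))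
      MeasureTheory.volume (-Real.pi) Real.pi ∧
    -- the average entropy
    Filter.Tendsto
      (fun n : ℕ => symbolEntropy (processMarginal (compatibleExtension A B X) Q (n + 1)) /
        ((n : ℝ) + 1))
      Filter.atTop
      (𝓝 (1 / (2 * Real.pi) * ∫ θ in (-Real.pi)..Real.pi,
        symbolEntropy (toeplitzSymbol A B X Q θ))) ∧
    -- the asymptotic entropy production
    Filter.Tendsto
      (fun n : ℕ => symbolEntropy (processMarginal (compatibleExtension A B X) Q (n + 1)) -
        symbolEntropy (processMarginal (compatibleExtension A B X) Q n))
      Filter.atTop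
      (𝓝 (1 / (2 * Real.pi) * ∫ θ in (-Real.pi)..Real.pi,
        symbolEntropy (toeplitzSymbol A B X Q θ))) := by
  have hA := norm_lt_one_of_isCP hΛ
  have hQs : IsSymbol Q := isSymbol_of_fixed hA hΓ hQ
  have hu : ∀ θ : ℝ, IsUnit (1 - Complex.exp (Complex.I * θ) • Aᴴ) := fun θ =>
    isUnit_one_sub_smul hA (by rw [mul_comm, Complex.norm_exp_ofReal_mul_I])
  have hσ := continuous_toeplitzSymbol (B := B) (X := X) (Q := Q) hu
  have hs : ∀ θ, IsSymbol (toeplitzSymbol A B X Q θ) := fun θ =>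
    toeplitzSymbol_isSymbol hQs hΓ hΛ hQ (hu θ)
  have hproc : processMarginal (compatibleExtension A B X) Q = blockToeplitz A Q (Q - B + X) :=
    funext fun n => processMarginal_eq_blockToeplitz A B X Q hΓ.1.1 hQs.isHermitian hQ n
  have hT := processMarginal_isSymbol hΛ hQs
  rw [hproc] at hT ⊢
  have havg := tendsto_entropy_blockToeplitz hA hσ hs hT
  refine ⟨hT, hu, hs, fun n j k a b => toeplitzBlock_eq_integral hA hσ j k a b,
    (continuous_symbolEntropy hσ hs).intervalIntegrable _ _, havg, ?_⟩
  exact tendsto_sub_of_tendsto_div (u := fun n => symbolEntropy (blockToeplitz A Q (Q - B + X) n))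
    (fun n => (hT n).entropy_nonneg)
    (fun n => symbolEntropy_blockToeplitz_concave (hT (n + 2))) havg
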